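/- Let $n\ge 2$ and let $\pm[n]=\{1,\dots,n,-n,\dots,-1\}$, totally ordered by $1<2<\dots<n<-n<\dots<-2<-1$. **Groups.** A signed permutation is a permutation $w$ of $\pm[n]$ with $w(-x)=-w(x)$ for all $x$; its one-line notation is $[w(1),\dots,w(n)]$, and its unfolding is the word $w(1),\dots,w(n),w(-n),\dots,w(-1)$, i.e. the one-line notation followed by its reversed copy with all signs flipped. The product of signed permutations is composition, $(wv)(x)=w(v(x))$. Let $D_n$ be the group of even signed permutations, those whose one-line notation has an even number of negative entries. Its simple generators are $s_1,\dots,s_n$, where for $1\le i<n$ the reflection $s_i$ exchanges $i\leftrightarrow i+1$ and $-i\leftrightarrow -(i+1)$, and $s_n$ exchanges $n-1\leftrightarrow -n$ and $n\leftrightarrow -(n-1)$. The Coxeter matrix has $m_{ij}=3$ if $i,j$ are joined in the type $D_n$ diagram (the path $s_1 - s_2 - \cdots - s_{n-1}$ together with an edge joining $s_{n-2}$ and $s_n$ when $n\ge 3$), and $m_{ij}=2$ for other $i\neq j$. **Demazure product.** The Coxeter monoid (0-Hecke monoid) of $D_n$ is the monoid with generators $s_1,\dots,s_n$, product $\star$,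 and relations $s_i\star s_i=s_i$ together with the braid relations $s_i\star s_j\star s_i\star\cdots=s_j\star s_i\star s_j\star\cdots$ ($m_{ij}$ factors on each side, $i\ne j$). Each $w\in D_n$ is identified with the element $s_{i_1}\star\cdots\star s_{i_k}$ of the monoid, where $s_{i_1}\cdots s_{i_k}$ is a reduced expression of $w$ (an expression of minimal length in the group $D_n$). The Demazure product of $w,v\in D_n$ is the element $w\star v\in D_n$ obtained in this way. **Hopping.** For $t\in\pm[n]$ and a list $L$ of elements of $\pm[n]$, the hopping operator $h_{t,L}$ acts on a signed permutation $u$ as follows: among the entries of $L$ that are greater than $t$ and lie to the right of $t$ in the unfolding of $u$, let $q$ be the one furthest to the right in the list $L$; if there is such a $q$, swap $t$ with $q$ and $-t$ with $-q$ in the unfolding of $u$ (only $t$ with $q$ if $q=-t$), and repeat with the resulting signed permutation; stop when there is no such $q$. For $w\in D_n$ and $1\le i\le n-1$ let $w{\nwarrow} i$ be the list obtained from the part of the unfolding of $w$ strictly to the left of $i$ by keeping only the entries in the open interval $(i,-i)$, in their order. **Theorem.** For all $w,v\in D_n$, $$w\star v \;=\; h_{n-1,\,w\nwarrow (n-1)}\cdots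 h_{2,\,w\nwarrow 2}\,h_{1,\,w\nwarrow 1}(wv),$$ where $h_{1,w\nwarrow 1}$ is applied first. (In particular, the right-hand side, which is computed from one-line notation alone, is again an even signed permutation.) -/

import Mathlib

open Equiv

namespace TypeD

/-! ### Letters and signed permutations -/

/-- The set `±[n] = {1, …, n, -n, …, -1}` with its total order `1 < 2 < ⋯ < n < -n < ⋯ < -2 < -1`,
realised as the ordered set `{0, …, 2n - 1}`: the letter `a` (for `1 ≤ a ≤ n`) is the element
`a - 1`, and the letter `-a` is the element `2n - a`. Negation of letters is `Fin.rev`. -/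
abbrev Letter (n : ℕ) : Type := Fin (2 * n)

/-- The positive letter `i + 1`, for `i : Fin n`. -/
def pos {n : ℕ} (i : Fin n) : Letter n := ⟨i, by omega⟩

/-- The group `B_n` of signed permutations: the permutations `w` of `±[n]` such that
`w (-x) = - w x`. Its product is composition, `(v * w) x = v (w x)`. The one-line notation of `w`
is `[w 1, …, w n]`. -/
def SignedPerm (n : ℕ) : Subgroup (Perm (Letter n)) where
  carrier := {w | ∀ x, w x.rev = (w x).rev}
  one_mem' := fun _ => rfl
  mul_mem' := by
    intro a b ha hb x
    have h1 := hb x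
    have h2 := ha (b x)
    simp only [Perm.mul_apply]
    rw [h1, h2]
  inv_mem' := by
    intro a ha x
    rw [Perm.inv_eq_iff_eq, ha]
    simp

/-- The number of negative entries in the one-line notation `[w 1, …, w n]`. -/
def negCount {n : ℕ} (w : SignedPerm n) : ℕ :=
  (Finset.univ.filter fun i : Fin n => n ≤ (w.1 (pos i) : ℕ)).card

/-- Sign of a letter. -/
def letterSign {n : ℕ} (x : Letter n) : ℤˣ := if n ≤ (x : ℕ) then -1 else 1

/-- Absolute value of a letter (as an element of `Fin n`, so shifted by one). -/
def letterAbs {n : ℕ} (x : Letter n) : Fin n :=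
  if h : n ≤ (x : ℕ) then ⟨2 * n - 1 - x, by omega⟩ else ⟨x, by omega⟩

theorem letter_cases {n : ℕ} (x : Letter n) :
    (letterSign x = 1 ∧ x = pos (letterAbs x)) ∨
      (letterSign x = -1 ∧ x = (pos (letterAbs x)).rev) := by
  by_cases h : n ≤ (x : ℕ)
  · right
    refine ⟨by simp [letterSign, h], ?_⟩
    ext
    simp [letterAbs, h, pos, Fin.val_rev]
    omega
  · left
    refine ⟨by simp [letterSign, h], ?_⟩
    ext
    simp [letterAbs, h, pos]

theorem letterSign_rev {n : ℕ} (x : Letter n) : letterSign x.rev = - letterSign x := by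
  unfold letterSign
  rw [Fin.val_rev]
  by_cases h : n ≤ (x : ℕ)
  · rw [if_neg (by omega), if_pos h]; simp
  · rw [if_pos (by omega), if_neg h]

theorem letterSign_apply {n : ℕ} (v : SignedPerm n) (x : Letter n) :
    letterSign (v.1 x) = letterSign x * letterSign (v.1 (pos (letterAbs x))) := by
  rcases letter_cases x with ⟨h1, h2⟩ | ⟨h1, h2⟩
  · rw [h1, one_mul, ← h2]
  · rw [h1]
    conv_lhs => rw [h2, v.2, letterSign_rev]
    simp

theorem prod_letterSign {n : ℕ} (w : SignedPerm n) :
    ∏ i : Fin n, letterSign (w.1 (pos i)) = (-1) ^ negCount w := by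
  simp [letterSign, negCount, Finset.prod_ite]

theorem letterAbs_bijective {n : ℕ} (w : SignedPerm n) :
    Function.Bijective fun i : Fin n => letterAbs (w.1 (pos i)) := by
  rw [← Finite.injective_iff_bijective]
  intro i j hij
  simp only at hij
  have key : pos i = pos j ∨ pos i = (pos j).rev := by
    rcases letter_cases (w.1 (pos i)) with ⟨_, h2⟩ | ⟨_, h2⟩ <;>
      rcases letter_cases (w.1 (pos j)) with ⟨_, h4⟩ | ⟨_, h4⟩ <;> rw [hij] at h2
    · left; exact w.1.injective (h2.trans h4.symm)
    · right; apply w.1.injective; rw [w.2, h4, Fin.rev_rev, h2]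
    · right; apply w.1.injective; rw [w.2, h4, ← h2]
    · left; exact w.1.injective (h2.trans h4.symm)
  rcases key with h | h
  · have := congrArg Fin.val h
    simp only [pos] at this
    exact Fin.ext this
  · have := congrArg Fin.val h
    simp only [pos, Fin.val_rev] at this
    omega

theorem neg_one_pow_negCount_mul {n : ℕ} (v w : SignedPerm n) :
    (-1 : ℤˣ) ^ negCount (v * w) = (-1) ^ negCount v * (-1) ^ negCount w := by
  rw [← prod_letterSign, ← prod_letterSign, ← prod_letterSign]
  have h : ∀ i : Fin n, letterSign ((v * w).1 (pos i)) =
      letterSign (w.1 (pos i)) * letterSign (v.1 (pos (letterAbs (w.1 (pos i))))) :=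
    fun i => letterSign_apply v (w.1 (pos i))
  simp_rw [h]
  rw [Finset.prod_mul_distrib, mul_comm]
  congr 1
  exact (letterAbs_bijective w).prod_comp fun i => letterSign (v.1 (pos i))

theorem even_iff_pow {k : ℕ} : Even k ↔ (-1 : ℤˣ) ^ k = 1 := by
  rcases Nat.even_or_odd k with h | h
  · simp [h]
  · simp [h.neg_one_pow, Nat.not_even_iff_odd.2 h]

/-- The group `D_n` of even signed permutations: the signed permutations whose one-line notation
has an even number of negative entries. -/
def EvenSignedPerm (n : ℕ) : Subgroup (SignedPerm n) where
  carrier := {w | Even (negCount w)}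
  one_mem' := by
    have h : negCount (1 : SignedPerm n) = 0 := by
      unfold negCount
      rw [Finset.card_eq_zero, Finset.filter_eq_empty_iff]
      intro i _
      simp [pos]
    simp [h]
  mul_mem' := by
    intro a b ha hb
    simp only [Set.mem_ofPred_eq, even_iff_pow] at *
    rw [neg_one_pow_negCount_mul, ha, hb, one_mul]
  inv_mem' := by
    intro a ha
    simp only [Set.mem_ofPred_eq, even_iff_pow] at *
    have h := neg_one_pow_negCount_mul a⁻¹ a
    have h1 : negCount (1 : SignedPerm n) = 0 := by
      unfold negCount
      rw [Finset.card_eq_zero, Finset.filter_eq_empty_iff]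
      intro i _
      simp [pos]
    rw [inv_mul_cancel, h1, ha, mul_one, pow_zero] at h
    exact h.symm

/-! ### Simple reflections -/

/-- The signed permutation that exchanges `a` with `b` and `-a` with `-b`
(only `a` with `b` if `b = -a`). -/
def signedSwap {n : ℕ} (a b : Letter n) : SignedPerm n :=
  ⟨if b = a.rev then swap a b else swap a b * swap a.rev b.rev, by
    intro x
    by_cases h : b = a.rev
    · rw [if_pos h]
      simp only [swap_apply_def, Fin.ext_iff, Fin.val_rev, apply_ite Fin.rev,
        apply_ite Fin.val] at h ⊢
      split_ifs <;> omega
    · rw [if_neg h]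
      simp only [Perm.mul_apply, swap_apply_def, Fin.ext_iff, Fin.val_rev, apply_ite Fin.rev,
        apply_ite Fin.val] at h ⊢
      split_ifs <;> omega⟩

theorem signedSwap_val {n : ℕ} {a b : Letter n} (h : b ≠ a.rev) :
    (signedSwap a b).1 = swap a b * swap a.rev b.rev := if_neg h

theorem even_negCount_signedSwap_pos {n : ℕ} (i j : Fin n) (hij : i ≠ j) :
    Even (negCount (signedSwap (pos i) (pos j))) := by
  have h : negCount (signedSwap (pos i) (pos j)) = 0 := by
    unfold negCount
    rw [Finset.card_eq_zero, Finset.filter_eq_empty_iff]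
    intro k _
    have hij' : (i : ℕ) ≠ j := fun h => hij (Fin.ext h)
    have h1 : pos j ≠ (pos i).rev := by
      simp only [pos, ne_eq, Fin.ext_iff, Fin.val_rev]
      omega
    simp only [signedSwap_val h1]
    simp only [Perm.mul_apply, swap_apply_def, pos, Fin.ext_iff,
      Fin.val_rev, apply_ite Fin.val]
    split_ifs <;> omega
  simp [h]

theorem even_negCount_signedSwap_neg {n : ℕ} (i j : Fin n) (hij : i ≠ j) :
    Even (negCount (signedSwap (pos i) (pos j).rev)) := by
  have h : negCount (signedSwap (pos i) (pos j).rev) = 2 := by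
    unfold negCount
    refine Eq.trans ?_ (Finset.card_pair hij)
    congr 1
    ext k
    have hij' : (i : ℕ) ≠ j := fun h => hij (Fin.ext h)
    have h1 : (pos j).rev ≠ (pos i).rev := by
      simp only [pos, ne_eq, Fin.ext_iff, Fin.val_rev]
      omega
    simp only [signedSwap_val h1]
    simp only [Perm.mul_apply, swap_apply_def, pos, Fin.ext_iff,
      Fin.val_rev, apply_ite Fin.val, Finset.mem_filter, Finset.mem_univ, true_and,
      Finset.mem_insert, Finset.mem_singleton]
    split_ifs <;> omega
  rw [h]
  exact even_two

/-- The simple reflections of `D_n`, `n ≥ 2`. For `i < n - 1` this is `s_{i+1}`, which exchanges the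
letters `i + 1` and `i + 2` (and their negatives). For `i = n - 1` it is `s_n`, which exchanges
`n - 1` with `-n` (and `-(n - 1)` with `n`). -/
def simpleReflection {n : ℕ} (hn : 2 ≤ n) (i : Fin n) : EvenSignedPerm n :=
  if h : (i : ℕ) + 1 < n then
    ⟨signedSwap (pos i) (pos ⟨i + 1, h⟩),
      even_negCount_signedSwap_pos _ _ (by simp [Fin.ext_iff])⟩
  else
    ⟨signedSwap (pos ⟨n - 2, by omega⟩) (pos ⟨n - 1, by omega⟩).rev,
      even_negCount_signedSwap_neg _ _ (by simp only [ne_eq, Fin.ext_iff]; omega)⟩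

/-- The Coxeter matrix of type `D_n`: the nodes `0, …, n - 2` form a path, and the last node `n - 1`
is joined to the node `n - 3` only. Joined nodes have label `3`, distinct nodes that are not joined
have label `2`. -/
def coxeterMatrix (n : ℕ) : CoxeterMatrix (Fin n) where
  M := Matrix.of fun i j =>
    if i = j then 1
    else if ((i : ℕ) + 1 = j ∧ (j : ℕ) + 1 < n) ∨ ((j : ℕ) + 1 = i ∧ (i : ℕ) + 1 < n) ∨
        ((i : ℕ) + 2 = j ∧ (j : ℕ) + 1 = n) ∨ ((j : ℕ) + 2 = i ∧ (i : ℕ) + 1 = n) then 3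
    else 2
  isSymm := by
    ext i j
    simp only [Matrix.transpose_apply, Matrix.of_apply]
    simp only [Fin.ext_iff]
    split_ifs <;> first | rfl | (exfalso; omega)
  diagonal := by simp
  off_diagonal := by
    intro i j h
    simp only [Matrix.of_apply, if_neg h]
    split_ifs <;> simp

/-! ### The Demazure product -/

section Demazure

variable {ι W : Type*}

/-- The defining relations of the Coxeter monoid (0-Hecke monoid): `s ⋆ s = s`, and the braid
relations `s ⋆ t ⋆ s ⋆ ⋯ = t ⋆ s ⋆ t ⋆ ⋯` with `m_{st}` factors on both sides, for `s ≠ t`. -/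
inductive CoxeterMonoidRel (M : CoxeterMatrix ι) : FreeMonoid ι → FreeMonoid ι → Prop
  | idem (i : ι) : CoxeterMonoidRel M (.ofList [i, i]) (.ofList [i])
  | braid (i j : ι) (h : i ≠ j) : CoxeterMonoidRel M
      (.ofList (CoxeterSystem.alternatingWord i j (M i j)))
      (.ofList (CoxeterSystem.alternatingWord j i (M i j)))

/-- The Coxeter monoid (0-Hecke monoid) of a Coxeter matrix. -/
abbrev CoxeterMonoid (M : CoxeterMatrix ι) : Type _ := PresentedMonoid (CoxeterMonoidRel M)

/-- The value of a word `s_1 ⋯ s_k` in the Coxeter monoid. -/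
def starProd (M : CoxeterMatrix ι) (l : List ι) : CoxeterMonoid M :=
  PresentedMonoid.mk (CoxeterMonoidRel M) (.ofList l)

variable [Group W]

/-- `l` is a reduced expression for `w` in the generators `s`: it has product `w` in the group, and
no shorter word has. -/
def IsReducedExpr (s : ι → W) (l : List ι) (w : W) : Prop :=
  (l.map s).prod = w ∧ ∀ l' : List ι, (l'.map s).prod = w → l.length ≤ l'.length

/-- `u` is a Demazure product of `v` and `w`. Here the elements of the group are regarded as elements
of the Coxeter monoid, `w` being identified with the `⋆`-product of a reduced expression. -/
def IsDemazureProduct (M : CoxeterMatrix ι) (s : ι → W) (v w u : W) : Prop :=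
  ∃ a b c : List ι, IsReducedExpr s a v ∧ IsReducedExpr s b w ∧ IsReducedExpr s c u ∧
    starProd M a * starProd M b = starProd M c

/-- The Demazure product `v ⋆ w` of a Coxeter group `W` with simple generators `s` and
Coxeter matrix `M`. -/
noncomputable def demazure (M : CoxeterMatrix ι) (s : ι → W) (v w : W) : W :=
  Classical.epsilon (IsDemazureProduct M s v w)

end Demazure

/-- The Demazure product of the Coxeter group `D_n`. -/
noncomputable def demazureD {n : ℕ} (hn : 2 ≤ n) (v w : EvenSignedPerm n) : EvenSignedPerm n :=
  demazure (coxeterMatrix n) (simpleReflection hn) v w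

/-! ### Unfolding, lifting and hopping -/

/-- The unfolding of `w`: the word `[w 1, …, w n, w (-n), …, w (-1)]`, that is, the one-line notation
of `w` followed by its reversed copy with all signs flipped. -/
def unfolding {n : ℕ} (w : SignedPerm n) : List (Letter n) := List.ofFn fun p => w.1 p

/-- The lifting `w ↖ t`: the subword of the unfolding of `w` that lies strictly to the left of `t`,
restricted to the entries in the open interval `(t, -t)`. -/
def lifting {n : ℕ} (w : SignedPerm n) (t : Letter n) : List (Letter n) :=
  ((unfolding w).takeWhile fun x => x ≠ t).filter fun x => t < x ∧ x < t.rev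

/-- The letter with which the hopping operator exchanges `t`: among the entries of `L` that are
greater than `t` and lie to the right of `t` in the unfolding of `w`, the one furthest to the right
in the list `L`. (The position of a letter `x` in the unfolding of `w` is `w⁻¹ x`.) -/
def hopTarget {n : ℕ} (t : Letter n) (L : List (Letter n)) (w : SignedPerm n) :
    Option (Letter n) :=
  (L.filter fun q => t < q ∧ w.1⁻¹ t < w.1⁻¹ q).getLast?

theorem hopTarget_spec {n : ℕ} {t : Letter n} {L : List (Letter n)} {w : SignedPerm n}
    {q : Letter n} (h : hopTarget t L w = some q) : t < q ∧ w.1⁻¹ t < w.1⁻¹ q := by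
  have h1 := List.mem_of_getLast? h
  simpa using (List.mem_filter.1 h1).2

theorem signedSwap_inv_apply_left {n : ℕ} {t q : Letter n} (h : t ≠ q) :
    (signedSwap t q).1⁻¹ t = q := by
  rw [Perm.inv_eq_iff_eq]
  simp only [signedSwap]
  by_cases h1 : q = t.rev
  · rw [if_pos h1, swap_apply_right]
  · rw [if_neg h1, Perm.mul_apply, swap_apply_of_ne_of_ne h1, swap_apply_right]
    intro h2
    have := congrArg Fin.val h2
    rw [Fin.val_rev] at this
    omega

/-- The hopping operator `h_{t,L}` on signed permutations: as long as there is a letter `q` as in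
`hopTarget`, exchange `t` and `q` as well as `-t` and `-q` in the unfolding, and repeat. -/
def hop {n : ℕ} (t : Letter n) (L : List (Letter n)) (w : SignedPerm n) : SignedPerm n :=
  match h : hopTarget t L w with
  | none => w
  | some q => hop t L (signedSwap t q * w)
termination_by 2 * n - (w.1⁻¹ t : ℕ)
decreasing_by
  have hq := hopTarget_spec h
  have h1 : ((signedSwap t q * w).1)⁻¹ t = w.1⁻¹ q := by
    have h2 : ((signedSwap t q * w).1)⁻¹ = w.1⁻¹ * (signedSwap t q).1⁻¹ := mul_inv_rev _ _
    rw [h2, Perm.mul_apply, signedSwap_inv_apply_left hq.1.ne]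
  rw [h1]
  have h3 : (w.1⁻¹ t : ℕ) < (w.1⁻¹ q : ℕ) := hq.2
  have h4 := (w.1⁻¹ q).isLt
  omega

/-- `h_{n-1, w ↖ (n-1)} ⋯ h_{2, w ↖ 2} h_{1, w ↖ 1} u`: the operators are applied to `u` in the order
`1, 2, …, n - 1`. -/
def hopAll {n : ℕ} (w u : SignedPerm n) : SignedPerm n :=
  (List.finRange (n - 1)).foldl
    (fun u i =>
      hop (pos (i.castLE (Nat.sub_le n 1))) (lifting w (pos (i.castLE (Nat.sub_le n 1)))) u) u

end TypeD

/-! The proof peels right descents off `w` and shows that each one changes neither side of the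
formula.

Demazure side. Put `s_i ⋆ u = u` if `i` is a left descent of `u`, and `s_i ⋆ u = s_i u` otherwise.
These maps (`act`) satisfy the idempotent and braid relations, so the Coxeter monoid acts on the
group. Together with Matsumoto's theorem (`starProd_eq_of_reduced`) this computes `w ⋆ v` by letting
a reduced word of `w` act on `v` (`demazureD_eq`). Hence `w ⋆ v = (w s_i) ⋆ (s_i ⋆ v)` for every
right descent `i` of `w` (`demazureD_of_desc_inv`).

Hopping side. Suppose that `w` fixes all letters before `t` but not `t`. Some right descent `i`
moves `t` one step left in the unfolding: `w' = w s_i` is `w` with `t` exchanged with `q`, the last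
letter of `w ↖ t` (`exists_right_descent`). If `i` is a descent of `v`, then `q` is to the right of
`t` in `wv`, so the first hop exchanges `t` and `q` and produces `w' v = w' (s_i ⋆ v)`. Otherwise
`w' (s_i ⋆ v) = wv`, and `q` is already to the left of `t`. Either way `q` can no longer be hopped
over, so losing it from the list does no harm.

The difficulty special to type D is that `s_n` carries a letter past its own negative, so `w` and
`w'` may order a pair `q`, `-q` differently. This is harmless because the exchanges of `t` with `q`
and with `-q` commute (`hop_lifting_congr`). Once `w` fixes `1, …, n - 1` it is trivial, by parity,
and no operator is left. -/

namespace TypeD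

/-! ### Positions of letters and signed transpositions -/

section Letters

variable {n : ℕ}

/-- The position of the letter `x` in the unfolding of `u`. -/
def loc (u : SignedPerm n) (x : Letter n) : Letter n := u.1⁻¹ x

theorem loc_injective (u : SignedPerm n) : Function.Injective (loc u) := u.1⁻¹.injective

theorem loc_rev (u : SignedPerm n) (x : Letter n) : loc u x.rev = (loc u x).rev :=
  (SignedPerm n).inv_mem u.2 x

theorem apply_loc (u : SignedPerm n) (x : Letter n) : u.1 (loc u x) = x :=
  u.1.apply_symm_apply x

theorem loc_apply (u : SignedPerm n) (x : Letter n) : loc u (u.1 x) = x :=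
  u.1.symm_apply_apply x

theorem loc_mul (g u : SignedPerm n) (x : Letter n) : loc (g * u) x = loc u (loc g x) := by
  simp [loc, mul_inv_rev]

theorem signedSwap_apply {a b : Letter n} (h : b ≠ a.rev) (x : Letter n) :
    (signedSwap a b).1 x = if x = a then b else if x = b then a else
      if x = a.rev then b.rev else if x = b.rev then a.rev else x := by
  rw [signedSwap_val h]
  simp only [Perm.mul_apply, swap_apply_def, Fin.ext_iff, Fin.val_rev, apply_ite Fin.val,
    ne_eq] at h ⊢
  split_ifs <;> omega

theorem signedSwap_mul_self {a b : Letter n} (h : b ≠ a.rev) :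
    signedSwap a b * signedSwap a b = 1 := by
  apply Subtype.ext
  ext x
  change (((signedSwap a b).1 ((signedSwap a b).1 x) : Letter n) : ℕ) = x
  simp only [signedSwap_apply h]
  simp only [Fin.ext_iff, Fin.val_rev, apply_ite Fin.val, ne_eq] at h ⊢
  split_ifs <;> omega

theorem loc_signedSwap {a b : Letter n} (h : b ≠ a.rev) (x : Letter n) :
    loc (signedSwap a b) x = if x = a then b else if x = b then a else
      if x = a.rev then b.rev else if x = b.rev then a.rev else x := by
  rw [← signedSwap_apply h, loc,
    show (signedSwap a b).1⁻¹ = (signedSwap a b).1 from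
      congrArg Subtype.val (inv_eq_of_mul_eq_one_left (signedSwap_mul_self h))]

theorem loc_signedSwap_mul {a b : Letter n} (h : b ≠ a.rev) (u : SignedPerm n) (x : Letter n) :
    loc (signedSwap a b * u) x = if x = a then loc u b else if x = b then loc u a else
      if x = a.rev then (loc u b).rev else if x = b.rev then (loc u a).rev else loc u x := by
  rw [loc_mul, loc_signedSwap h]
  simp only [apply_ite (loc u), loc_rev]

/-- Conjugation by `w` relabels a reflection. This turns an exchange of positions, on the right of
`w`, into an exchange of letters, on the left. -/
theorem mul_signedSwap {a b : Letter n} (h : b ≠ a.rev) (w : SignedPerm n) :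
    w * signedSwap a b = signedSwap (w.1 a) (w.1 b) * w := by
  have h' : w.1 b ≠ (w.1 a).rev := by
    rw [← w.2]
    exact fun e => h (w.1.injective e)
  apply Subtype.ext
  ext x
  congr 1
  change w.1 ((signedSwap a b).1 x) = (signedSwap (w.1 a) (w.1 b)).1 (w.1 x)
  rw [signedSwap_apply h, signedSwap_apply h', ← w.2, ← w.2]
  simp only [w.1.injective.eq_iff, apply_ite w.1]

end Letters

/-! ### Simple roots, descents and length -/

section Length

variable {n : ℕ}

/-- The smaller of the two letters `lo i < hi i` exchanged by the `i`-th simple reflection. -/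
def lo (hn : 2 ≤ n) (i : Fin n) : Letter n :=
  ⟨if (i : ℕ) + 1 < n then i else n - 2, by split_ifs <;> omega⟩

/-- The larger of the two letters `lo i < hi i` exchanged by the `i`-th simple reflection. -/
def hi (hn : 2 ≤ n) (i : Fin n) : Letter n :=
  ⟨if (i : ℕ) + 1 < n then i + 1 else n, by split_ifs <;> omega⟩

theorem hi_ne_rev_lo (hn : 2 ≤ n) (i : Fin n) : hi hn i ≠ (lo hn i).rev := by
  simp only [hi, lo, ne_eq, Fin.ext_iff, Fin.val_rev]
  split_ifs <;> omega

theorem simpleReflection_eq (hn : 2 ≤ n) (i : Fin n) :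
    (simpleReflection hn i).1 = signedSwap (lo hn i) (hi hn i) := by
  unfold simpleReflection
  split_ifs with h
  · simp [lo, hi, pos, h]
  · have h1 : pos ⟨n - 2, by omega⟩ = lo hn i := by simp [lo, pos, h]
    have h2 : (pos ⟨n - 1, by omega⟩).rev = hi hn i := by
      simp only [hi, pos, h, if_false, Fin.ext_iff, Fin.val_rev]
      omega
    rw [← h1, ← h2]

theorem simpleReflection_mul_self (hn : 2 ≤ n) (i : Fin n) :
    simpleReflection hn i * simpleReflection hn i = 1 := by
  apply Subtype.ext
  change (simpleReflection hn i).1 * (simpleReflection hn i).1 = 1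
  rw [simpleReflection_eq, signedSwap_mul_self (hi_ne_rev_lo hn i)]

theorem simpleReflection_mul_cancel (hn : 2 ≤ n) (i : Fin n) (u : EvenSignedPerm n) :
    simpleReflection hn i * (simpleReflection hn i * u) = u := by
  rw [← mul_assoc, simpleReflection_mul_self, one_mul]

/-- The action of the `i`-th simple reflection on letters. -/
def refl (hn : 2 ≤ n) (i : Fin n) (x : Letter n) : Letter n :=
  if x = lo hn i then hi hn i else if x = hi hn i then lo hn i else
    if x = (lo hn i).rev then (hi hn i).rev else if x = (hi hn i).rev then (lo hn i).rev else x

theorem simpleReflection_apply (hn : 2 ≤ n) (i : Fin n) (x : Letter n) :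
    (simpleReflection hn i).1.1 x = refl hn i x := by
  rw [simpleReflection_eq, signedSwap_apply (hi_ne_rev_lo hn i), refl]

theorem loc_simpleReflection (hn : 2 ≤ n) (i : Fin n) (x : Letter n) :
    loc (simpleReflection hn i).1 x = refl hn i x := by
  rw [simpleReflection_eq, loc_signedSwap (hi_ne_rev_lo hn i), refl]

theorem loc_simpleReflection_mul (hn : 2 ≤ n) (i : Fin n) (u : EvenSignedPerm n) (x : Letter n) :
    loc (simpleReflection hn i * u).1 x = loc u.1 (refl hn i x) := by
  rw [← loc_simpleReflection]
  exact loc_mul _ _ _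

theorem loc_mul_simpleReflection (hn : 2 ≤ n) (i : Fin n) (u : EvenSignedPerm n) (x : Letter n) :
    loc (u * simpleReflection hn i).1 x = refl hn i (loc u.1 x) := by
  rw [← loc_simpleReflection]
  exact loc_mul _ _ _

/-- In this arithmetic form, questions about the order of letters are decided by `omega`. -/
theorem refl_val (hn : 2 ≤ n) (i : Fin n) (x : Letter n) : (refl hn i x : ℕ) =
    if (i : ℕ) + 1 < n then
      if (x : ℕ) = i then (i + 1 : ℕ) else if (x : ℕ) = i + 1 then (i : ℕ) else
        if (x : ℕ) + i + 1 = 2 * n then (x - 1 : ℕ) else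
          if (x : ℕ) + i + 2 = 2 * n then (x + 1 : ℕ) else (x : ℕ)
    else if (x : ℕ) + 2 = n ∨ (x : ℕ) + 1 = n then (x + 2 : ℕ) else
      if (x : ℕ) = n ∨ (x : ℕ) = n + 1 then (x - 2 : ℕ) else (x : ℕ) := by
  simp only [refl, lo, hi, Fin.ext_iff, Fin.val_rev, apply_ite Fin.val]
  split_ifs <;> omega

theorem refl_refl (hn : 2 ≤ n) (i : Fin n) (x : Letter n) : refl hn i (refl hn i x) = x := by
  rw [← simpleReflection_apply, ← loc_simpleReflection, apply_loc]

theorem refl_rev (hn : 2 ≤ n) (i : Fin n) (x : Letter n) :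
    refl hn i x.rev = (refl hn i x).rev := by
  rw [← simpleReflection_apply, ← simpleReflection_apply]
  exact (simpleReflection hn i).1.2 x

theorem refl_lo (hn : 2 ≤ n) (i : Fin n) : refl hn i (lo hn i) = hi hn i := by
  simp [refl]

theorem refl_hi (hn : 2 ≤ n) (i : Fin n) : refl hn i (hi hn i) = lo hn i := by
  rw [← refl_lo, refl_refl]

theorem lo_lt_hi (hn : 2 ≤ n) (i : Fin n) : lo hn i < hi hn i := by
  simp only [lo, hi, Fin.lt_def]
  split_ifs <;> omega

/-- A simple reflection preserves the order of all pairs of letters but its own. -/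
theorem refl_lt_refl (hn : 2 ≤ n) (i : Fin n) {x y : Letter n} (h : x < y) (h1 : y ≠ x.rev)
    (h2 : ¬ (x = lo hn i ∧ y = hi hn i)) (h3 : ¬ (x = (hi hn i).rev ∧ y = (lo hn i).rev)) :
    refl hn i x < refl hn i y := by
  rw [Fin.lt_def] at h ⊢
  simp only [refl_val]
  simp only [lo, hi, ne_eq, Fin.ext_iff, Fin.val_rev] at h1 h2 h3
  split_ifs at * <;> omega

/-! ### Inversions and descents -/

/-- The pairs of letters that `u` has in reversed order, where opposite letters are not
compared. -/
def invPairs (u : SignedPerm n) : Finset (Letter n × Letter n) :=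
  Finset.univ.filter fun p => p.1 < p.2 ∧ p.2 ≠ p.1.rev ∧ loc u p.2 < loc u p.1

/-- Twice the Coxeter length of `u`. -/
def invCount (u : EvenSignedPerm n) : ℕ := (invPairs u.1).card

/-- `i` is a left descent of `u`. -/
def Desc (hn : 2 ≤ n) (i : Fin n) (u : EvenSignedPerm n) : Prop :=
  loc u.1 (hi hn i) < loc u.1 (lo hn i)

theorem not_desc (hn : 2 ≤ n) (i : Fin n) (u : EvenSignedPerm n) :
    ¬ Desc hn i u ↔ loc u.1 (lo hn i) < loc u.1 (hi hn i) := by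
  have : loc u.1 (lo hn i) ≠ loc u.1 (hi hn i) := fun e =>
    (lo_lt_hi hn i).ne (loc_injective _ e)
  rw [Desc, not_lt]
  exact ⟨fun h => lt_of_le_of_ne h this, le_of_lt⟩

theorem desc_simpleReflection_mul (hn : 2 ≤ n) (i : Fin n) (u : EvenSignedPerm n) :
    Desc hn i (simpleReflection hn i * u) ↔ ¬ Desc hn i u := by
  rw [not_desc, Desc, loc_simpleReflection_mul, loc_simpleReflection_mul, refl_lo, refl_hi]

/-- The reflection acts on pairs of letters and carries the inversions of `u` to inversions of `s_i
u`. The only new ones are the pair of the reflection itself and its mirror image under negation,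
hence the increment 2. -/
theorem invCount_of_not_desc (hn : 2 ≤ n) (i : Fin n) (u : EvenSignedPerm n)
    (h : ¬ Desc hn i u) : invCount (simpleReflection hn i * u) = invCount u + 2 := by
  have hl := lo_lt_hi hn i
  have hr := hi_ne_rev_lo hn i
  have hu := (not_desc hn i u).1 h
  obtain ⟨e, he⟩ : ∃ e : Letter n × Letter n ↪ Letter n × Letter n,
      ∀ a b, e (a, b) = (refl hn i a, refl hn i b) :=
    ⟨⟨fun p => (refl hn i p.1, refl hn i p.2), fun p q hpq => by
      have h1 := congrArg Prod.fst hpq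
      have h2 := congrArg Prod.snd hpq
      simp only at h1 h2
      ext1
      · rw [← refl_refl hn i p.1, h1, refl_refl]
      · rw [← refl_refl hn i p.2, h2, refl_refl]⟩, fun _ _ => rfl⟩
  have key : invPairs (simpleReflection hn i * u).1 =
      insert (lo hn i, hi hn i) (insert ((hi hn i).rev, (lo hn i).rev)
        ((invPairs u.1).map e)) := by
    ext ⟨x, y⟩
    simp only [invPairs, Finset.mem_insert, Finset.mem_map, Finset.mem_filter, Finset.mem_univ,
      true_and, Prod.exists, loc_simpleReflection_mul, Prod.mk.injEq]
    constructor
    · rintro ⟨h1, h2, h3⟩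
      by_cases c1 : x = lo hn i ∧ y = hi hn i
      · exact Or.inl c1
      by_cases c2 : x = (hi hn i).rev ∧ y = (lo hn i).rev
      · exact Or.inr (Or.inl c2)
      refine Or.inr (Or.inr ⟨refl hn i x, refl hn i y,
        ⟨refl_lt_refl hn i h1 h2 c1 c2, ?_, h3⟩, ?_⟩)
      · rw [← refl_rev]
        intro e1
        apply h2
        rw [← refl_refl hn i y, e1, refl_refl]
      · simp [he, refl_refl]
    · rintro (⟨rfl, rfl⟩ | ⟨rfl, rfl⟩ | ⟨a, b, ⟨h1, h2, h3⟩, h4⟩)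
      · rw [refl_lo, refl_hi]
        exact ⟨hl, hr, hu⟩
      · rw [refl_rev, refl_rev, refl_lo, refl_hi, loc_rev, loc_rev, Fin.rev_lt_rev,
          Fin.rev_lt_rev, Fin.rev_rev]
        exact ⟨hl, fun e => hr e.symm, hu⟩
      · simp only [he, Prod.mk.injEq] at h4
        obtain ⟨rfl, rfl⟩ := h4
        rw [refl_refl, refl_refl]
        refine ⟨refl_lt_refl hn i h1 h2 ?_ ?_, ?_, h3⟩
        · rintro ⟨rfl, rfl⟩
          exact lt_asymm hu h3
        · rintro ⟨rfl, rfl⟩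
          rw [loc_rev, loc_rev, Fin.rev_lt_rev] at h3
          exact lt_asymm hu h3
        · rw [← refl_rev]
          intro e1
          apply h2
          rw [← refl_refl hn i b, e1, refl_refl]
  have m2 : ((hi hn i).rev, (lo hn i).rev) ∉ (invPairs u.1).map e := by
    simp only [invPairs, Finset.mem_map, Finset.mem_filter, Finset.mem_univ, true_and,
      Prod.exists, not_exists, he, Prod.mk.injEq, not_and]
    rintro a b ⟨h1, -, -⟩ h2 h3
    have h2' := congrArg (refl hn i) h2
    have h3' := congrArg (refl hn i) h3
    rw [refl_refl, refl_rev, refl_hi] at h2'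
    rw [refl_refl, refl_rev, refl_lo] at h3'
    rw [h2', h3', Fin.rev_lt_rev] at h1
    exact lt_asymm hl h1
  have m1 : (lo hn i, hi hn i) ∉ insert ((hi hn i).rev, (lo hn i).rev) ((invPairs u.1).map e) := by
    simp only [invPairs, Finset.mem_insert, Finset.mem_map, Finset.mem_filter, Finset.mem_univ,
      true_and, Prod.exists, not_or, not_exists, he, Prod.mk.injEq,
      not_and]
    refine ⟨fun e1 => absurd (by rw [e1, Fin.rev_rev]) hr, ?_⟩
    rintro a b ⟨h1, -, -⟩ h2 h3
    have h2' := congrArg (refl hn i) h2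
    have h3' := congrArg (refl hn i) h3
    rw [refl_refl, refl_lo] at h2'
    rw [refl_refl, refl_hi] at h3'
    rw [h2', h3'] at h1
    exact lt_asymm hl h1
  rw [invCount, key, Finset.card_insert_of_notMem m1, Finset.card_insert_of_notMem m2,
    Finset.card_map, invCount]

theorem invCount_of_desc (hn : 2 ≤ n) (i : Fin n) (u : EvenSignedPerm n)
    (h : Desc hn i u) : invCount (simpleReflection hn i * u) + 2 = invCount u := by
  rw [← invCount_of_not_desc hn i _ fun h' => (desc_simpleReflection_mul hn i u).1 h' h,
    simpleReflection_mul_cancel]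

/-- An inverted pair of letters corresponds to the inverted pair of its positions. This transfers
length statements from left to right multiplication. -/
theorem invCount_inv (u : EvenSignedPerm n) : invCount u⁻¹ = invCount u := by
  refine Finset.card_bij' (fun p _ => (loc u⁻¹.1 p.2, loc u⁻¹.1 p.1))
    (fun p _ => (loc u.1 p.2, loc u.1 p.1)) ?_ ?_ ?_ ?_
  all_goals
    have e : ∀ x, loc u⁻¹.1 x = u.1.1 x := fun x => rfl
    rintro ⟨x, y⟩ hp
    simp only [invPairs, Finset.mem_filter, Finset.mem_univ, true_and, e, loc_apply,
      apply_loc] at hp ⊢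
  · refine ⟨hp.2.2, ?_, hp.1⟩
    rw [← u.1.2]
    intro h
    exact hp.2.1 (by rw [u.1.1.injective h, Fin.rev_rev])
  · refine ⟨hp.2.2, ?_, hp.1⟩
    rw [← loc_rev]
    intro h
    exact hp.2.1 (by rw [loc_injective _ h, Fin.rev_rev])

theorem invCount_one : invCount (1 : EvenSignedPerm n) = 0 := by
  rw [invCount, Finset.card_eq_zero, invPairs, Finset.filter_eq_empty_iff]
  rintro p - ⟨h1, -, h2⟩
  exact lt_asymm h1 h2

/-- An even signed permutation all of whose one-line entries are positive, but maybe the last, is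
positive. -/
theorem apply_last_lt (w : EvenSignedPerm n)
    (h : ∀ x : Letter n, (x : ℕ) + 1 < n → (w.1.1 x : ℕ) < n)
    (x : Letter n) (hx : (x : ℕ) < n) : (w.1.1 x : ℕ) < n := by
  by_contra hc
  have hx1 : (x : ℕ) + 1 = n := by
    by_contra h1
    exact hc (h x (by omega))
  have h2 : negCount w.1 = 1 := by
    rw [negCount, Finset.card_eq_one]
    refine ⟨⟨x, hx⟩, ?_⟩
    ext k
    simp only [Finset.mem_filter, Finset.mem_univ, true_and, Finset.mem_singleton]
    constructor
    · intro hk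
      by_contra hk1
      have := h (pos k) (by
        have := k.2
        simp only [Fin.ext_iff] at hk1
        simp only [pos]
        omega)
      omega
    · rintro rfl
      exact not_lt.1 hc
  have h3 : Even (negCount w.1) := w.2
  rw [h2] at h3
  exact absurd h3 (by decide)

theorem eq_one_of_fixes_pos (w : EvenSignedPerm n)
    (h : ∀ x : Letter n, (x : ℕ) < n → w.1.1 x = x) : w = 1 := by
  apply Subtype.ext
  apply Subtype.ext
  ext x
  congr 1
  change w.1.1 x = x
  by_cases hx : (x : ℕ) < n
  · exact h x hx
  · rw [← Fin.rev_rev x, w.1.2, h x.rev (by rw [Fin.val_rev]; omega)]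

/-- An even signed permutation that fixes all one-line entries but maybe the last is trivial. -/
theorem eq_one_of_fixes (w : EvenSignedPerm n)
    (h : ∀ x : Letter n, (x : ℕ) + 1 < n → w.1.1 x = x) : w = 1 := by
  apply eq_one_of_fixes_pos
  intro x hx
  by_cases hx1 : (x : ℕ) + 1 < n
  · exact h x hx1
  have h1 := apply_last_lt w (fun y hy => by rw [h y hy]; omega) x hx
  by_contra h2
  -- If the last entry were moved, its value would be an earlier letter, which is already fixed.
  have h3 := h (w.1.1 x) (by
    have : (w.1.1 x : ℕ) ≠ x := fun e => h2 (Fin.ext e)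
    omega)
  exact h2 (w.1.1.injective h3)

/-- Without descents the one-line notation of `u⁻¹` is increasing, and parity excludes a negative
last entry. An increasing sequence of `n` positive letters is `1, …, n`. -/
theorem eq_one_of_no_desc (hn : 2 ≤ n) (u : EvenSignedPerm n) (h : ∀ i, ¬ Desc hn i u) :
    u = 1 := by
  rw [← inv_eq_one]
  set w := u⁻¹ with hw
  have e : ∀ x, loc u.1 x = w.1.1 x := fun x => rfl
  have hd : ∀ i, w.1.1 (lo hn i) < w.1.1 (hi hn i) := fun i => by
    have := (not_desc hn i u).1 (h i)
    rwa [e, e] at this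
  have step : ∀ (k : ℕ) (hk : k + 1 < n),
      w.1.1 ⟨k, by omega⟩ < w.1.1 ⟨k + 1, by omega⟩ := fun k hk => by
    have := hd ⟨k, by omega⟩
    simpa only [lo, hi, hk, if_true] using this
  have last : w.1.1 ⟨n - 2, by omega⟩ < w.1.1 ⟨n, by omega⟩ := by
    have := hd ⟨n - 1, by omega⟩
    simpa only [lo, hi, show ¬ (n - 1 + 1 < n) by omega, if_false] using this
  have hrev : w.1.1 ⟨n, by omega⟩ = (w.1.1 ⟨n - 1, by omega⟩).rev := by
    rw [← w.1.2]
    congr 1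
    ext
    simp only [Fin.val_rev]
    omega
  have mono : ∀ (j k : ℕ) (hj : j ≤ k) (hk : k < n),
      (w.1.1 ⟨j, by omega⟩ : ℕ) + (k - j) ≤ w.1.1 ⟨k, by omega⟩ := by
    intro j k hj hk
    induction k, hj using Nat.le_induction with
    | base => omega
    | succ k hj ih =>
      have h1 := ih (by omega)
      have h2 := step k hk
      rw [Fin.lt_def] at h2
      omega
  -- The entry `w (n - 1)` precedes both `w n` and `-w n`, one of which is positive, so the first `n
  -- - 1` entries are positive.
  have hlt : ∀ x : Letter n, (x : ℕ) < n → (w.1.1 x : ℕ) < n := by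
    apply apply_last_lt
    intro x hx
    have h1 := step (n - 2) (by omega)
    have h2 := mono x (n - 2) (by omega) (by omega)
    rw [hrev] at last
    simp only [show n - 2 + 1 = n - 1 by omega] at h1
    rw [Fin.lt_def] at last h1
    rw [Fin.val_rev] at last
    simp only [Fin.eta] at h2
    omega
  apply eq_one_of_fixes_pos
  intro x hx
  have h1 := mono 0 x (by omega) hx
  have h2 := mono x (n - 1) (by omega) (by omega)
  have h3 := hlt ⟨n - 1, by omega⟩ (by simp only; omega)
  simp only [Fin.eta] at h1 h2
  ext
  omega

end Length

/-! ### The action of the Coxeter monoid on the group -/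

section Demazure

variable {n : ℕ}

open Classical in
/-- The Demazure product `s_i ⋆ u`. -/
noncomputable def act (hn : 2 ≤ n) (i : Fin n) (u : EvenSignedPerm n) : EvenSignedPerm n :=
  if Desc hn i u then u else simpleReflection hn i * u

theorem act_of_desc {hn : 2 ≤ n} {i : Fin n} {u : EvenSignedPerm n} (h : Desc hn i u) :
    act hn i u = u := if_pos h

theorem act_of_not_desc {hn : 2 ≤ n} {i : Fin n} {u : EvenSignedPerm n} (h : ¬ Desc hn i u) :
    act hn i u = simpleReflection hn i * u := if_neg h

theorem act_act (hn : 2 ≤ n) (i : Fin n) (u : EvenSignedPerm n) :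
    act hn i (act hn i u) = act hn i u := by
  by_cases h : Desc hn i u
  · rw [act_of_desc h, act_of_desc h]
  · rw [act_of_not_desc h, act_of_desc ((desc_simpleReflection_mul hn i u).2 h)]

/-! ### Braid relations for the action -/

/-- The `i`-th and `j`-th simple roots are `a < b` and `b < c`. -/
def Linked (hn : 2 ≤ n) (i j : Fin n) : Prop :=
  hi hn i = lo hn j ∧ refl hn i (hi hn j) = hi hn j ∧ refl hn j (lo hn i) = lo hn i

/-- The `i`-th and `j`-th simple reflections commute and fix the root of each other. -/
def Commuting (hn : 2 ≤ n) (i j : Fin n) : Prop :=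
  simpleReflection hn i * simpleReflection hn j = simpleReflection hn j * simpleReflection hn i ∧
    (∀ u, Desc hn i (simpleReflection hn j * u) ↔ Desc hn i u) ∧
      ∀ u, Desc hn j (simpleReflection hn i * u) ↔ Desc hn j u

/-- Both sides are the reflection that exchanges `lo i` with `hi j`, by conjugation. -/
theorem Linked.braid {hn : 2 ≤ n} {i j : Fin n} (h : Linked hn i j) :
    simpleReflection hn i * simpleReflection hn j * simpleReflection hn i =
      simpleReflection hn j * simpleReflection hn i * simpleReflection hn j := by
  obtain ⟨h1, h2, h3⟩ := h
  have key : ∀ a b : Fin n, ((simpleReflection hn a * simpleReflection hn b *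
      simpleReflection hn a : EvenSignedPerm n) : SignedPerm n) =
        signedSwap (refl hn a (lo hn b)) (refl hn a (hi hn b)) := by
    intro a b
    have h := mul_signedSwap (hi_ne_rev_lo hn b) (simpleReflection hn a).1
    rw [← simpleReflection_eq, simpleReflection_apply, simpleReflection_apply] at h
    rw [Subgroup.coe_mul, Subgroup.coe_mul, h, mul_assoc, ← Subgroup.coe_mul,
      simpleReflection_mul_self, Subgroup.coe_one, mul_one]
  apply Subtype.ext
  rw [key, key, h2, h3, h1, refl_lo, ← h1, refl_hi]

/-- All descent conditions involve only the relative positions of the three letters `lo i < hi i =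
lo j < hi j`, so it suffices to check each of their orders. -/
theorem Linked.act_braid {hn : 2 ≤ n} {i j : Fin n} (h : Linked hn i j) (u : EvenSignedPerm n) :
    act hn i (act hn j (act hn i u)) = act hn j (act hn i (act hn j u)) := by
  have hb' : simpleReflection hn i * (simpleReflection hn j * (simpleReflection hn i * u)) =
      simpleReflection hn j * (simpleReflection hn i * (simpleReflection hn j * u)) := by
    rw [← mul_assoc, ← mul_assoc, h.braid, mul_assoc, mul_assoc]
  obtain ⟨h1, h2, h3⟩ := h
  have ne1 : loc u.1 (lo hn i) ≠ loc u.1 (lo hn j) := fun e =>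
    (lo_lt_hi hn i).ne (by rw [h1, loc_injective _ e])
  have ne2 : loc u.1 (lo hn j) ≠ loc u.1 (hi hn j) := fun e =>
    (lo_lt_hi hn j).ne (loc_injective _ e)
  have ne3 : loc u.1 (lo hn i) ≠ loc u.1 (hi hn j) := fun e =>
    ((lo_lt_hi hn i).trans (h1 ▸ lo_lt_hi hn j)).ne (loc_injective _ e)
  have e1 : refl hn i (lo hn i) = lo hn j := by rw [refl_lo, h1]
  have e2 : refl hn i (lo hn j) = lo hn i := by rw [← h1, refl_hi]
  have e3 : refl hn j (lo hn j) = hi hn j := refl_lo _ _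
  have e4 : refl hn j (hi hn j) = lo hn j := refl_hi _ _
  rcases lt_or_gt_of_ne ne1 with c1 | c1 <;> rcases lt_or_gt_of_ne ne2 with c2 | c2 <;>
    rcases lt_or_gt_of_ne ne3 with c3 | c3 <;>
    first
    | (exfalso; order)
    | simp only [act, Desc, h1, loc_simpleReflection_mul, h2, h3, e1, e2, e3, e4, c1, c2, c3,
        c1.not_gt, c2.not_gt, c3.not_gt, if_true, if_false, hb']

theorem Commuting.act_comm {hn : 2 ≤ n} {i j : Fin n} (h : Commuting hn i j)
    (u : EvenSignedPerm n) : act hn i (act hn j u) = act hn j (act hn i u) := by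
  obtain ⟨h1, h2, h3⟩ := h
  by_cases ci : Desc hn i u <;> by_cases cj : Desc hn j u <;>
    simp [act, ci, cj, h2, h3, ← mul_assoc, h1]

theorem linked_of_succ (hn : 2 ≤ n) (i j : Fin n)
    (h : ((i : ℕ) + 1 = j ∧ (j : ℕ) + 1 < n) ∨ ((i : ℕ) + 2 = j ∧ (j : ℕ) + 1 = n)) :
    Linked hn i j := by
  refine ⟨?_, ?_, ?_⟩ <;> ext <;> simp only [refl_val, hi, lo] <;> split_ifs <;> omega

theorem signedSwap_rev_rev {a b : Letter n} (h : b ≠ a.rev) :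
    signedSwap b.rev a.rev = signedSwap a b := by
  have h' : a.rev ≠ b.rev.rev := by rwa [Fin.rev_rev, ne_comm]
  apply Subtype.ext
  ext x
  rw [signedSwap_apply h, signedSwap_apply h', Fin.rev_rev, Fin.rev_rev]
  simp only [Fin.ext_iff, Fin.val_rev, apply_ite Fin.val, ne_eq] at h ⊢
  split_ifs <;> omega

/-- Letters `lo j`, `hi j` under a simple reflection that is not joined to the `j`-th one. -/
theorem refl_lo_hi_of_ne (hn : 2 ≤ n) (i j : Fin n) (hij : i ≠ j)
    (h : ¬ (((i : ℕ) + 1 = j ∧ (j : ℕ) + 1 < n) ∨ ((j : ℕ) + 1 = i ∧ (i : ℕ) + 1 < n) ∨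
      ((i : ℕ) + 2 = j ∧ (j : ℕ) + 1 = n) ∨ ((j : ℕ) + 2 = i ∧ (i : ℕ) + 1 = n))) :
    (refl hn i (lo hn j) = lo hn j ∧ refl hn i (hi hn j) = hi hn j) ∨
      (refl hn i (lo hn j) = (hi hn j).rev ∧ refl hn i (hi hn j) = (lo hn j).rev) := by
  rw [ne_eq, Fin.ext_iff] at hij
  by_cases hi' : (i : ℕ) + 1 < n <;> by_cases hj' : (j : ℕ) + 1 < n
  · left
    constructor <;> ext <;> simp only [refl_val, lo, hi, hi', hj', if_true] <;>
      split_ifs <;> omega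
  -- The two ends of the fork, `s_{n-1}` and `s_n`, move the same letters; each sends the pair of
  -- the other to its mirror image.
  · by_cases h2 : (i : ℕ) + 2 = n
    · right
      constructor <;> ext <;> simp only [refl_val, lo, hi, hi', hj', if_true, if_false,
        Fin.val_rev] <;> split_ifs <;> omega
    · left
      constructor <;> ext <;> simp only [refl_val, lo, hi, hi', hj', if_true, if_false] <;>
        split_ifs <;> omega
  · by_cases h2 : (j : ℕ) + 2 = n
    · right
      constructor <;> ext <;> simp only [refl_val, lo, hi, hi', hj', if_true, if_false,
        Fin.val_rev] <;> split_ifs <;> omega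
    · left
      constructor <;> ext <;> simp only [refl_val, lo, hi, hi', hj', if_true, if_false] <;>
        split_ifs <;> omega
  · omega

theorem commuting_of_ne (hn : 2 ≤ n) (i j : Fin n) (hij : i ≠ j)
    (h : ¬ (((i : ℕ) + 1 = j ∧ (j : ℕ) + 1 < n) ∨ ((j : ℕ) + 1 = i ∧ (i : ℕ) + 1 < n) ∨
      ((i : ℕ) + 2 = j ∧ (j : ℕ) + 1 = n) ∨ ((j : ℕ) + 2 = i ∧ (i : ℕ) + 1 = n))) :
    Commuting hn i j := by
  have key : ∀ a b : Fin n, (refl hn a (lo hn b) = lo hn b ∧ refl hn a (hi hn b) = hi hn b) ∨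
      (refl hn a (lo hn b) = (hi hn b).rev ∧ refl hn a (hi hn b) = (lo hn b).rev) →
      ∀ u, Desc hn b (simpleReflection hn a * u) ↔ Desc hn b u := by
    intro a b hab u
    rw [Desc, Desc, loc_simpleReflection_mul, loc_simpleReflection_mul]
    rcases hab with ⟨h1, h2⟩ | ⟨h1, h2⟩ <;> rw [h1, h2]
    rw [loc_rev, loc_rev, Fin.rev_lt_rev]
  have hr := refl_lo_hi_of_ne hn i j hij h
  refine ⟨?_, key j i (refl_lo_hi_of_ne hn j i hij.symm (by omega)), key i j hr⟩
  have hm := mul_signedSwap (hi_ne_rev_lo hn j) (simpleReflection hn i).1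
  rw [← simpleReflection_eq, simpleReflection_apply, simpleReflection_apply] at hm
  apply Subtype.ext
  rw [Subgroup.coe_mul, Subgroup.coe_mul, hm]
  rcases hr with ⟨h1, h2⟩ | ⟨h1, h2⟩ <;> rw [h1, h2]
  · rw [← simpleReflection_eq]
  · rw [signedSwap_rev_rev (hi_ne_rev_lo hn j), ← simpleReflection_eq]

theorem coxeterMatrix_cases (hn : 2 ≤ n) (i j : Fin n) (hij : i ≠ j) :
    (coxeterMatrix n i j = 2 ∧ Commuting hn i j) ∨
      (coxeterMatrix n i j = 3 ∧ (Linked hn i j ∨ Linked hn j i)) := by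
  by_cases h : ((i : ℕ) + 1 = j ∧ (j : ℕ) + 1 < n) ∨ ((j : ℕ) + 1 = i ∧ (i : ℕ) + 1 < n) ∨
      ((i : ℕ) + 2 = j ∧ (j : ℕ) + 1 = n) ∨ ((j : ℕ) + 2 = i ∧ (i : ℕ) + 1 = n)
  · refine Or.inr ⟨(if_neg hij).trans (if_pos h), ?_⟩
    rcases h with h | h | h | h
    · exact Or.inl (linked_of_succ hn i j (Or.inl h))
    · exact Or.inr (linked_of_succ hn j i (Or.inl h))
    · exact Or.inl (linked_of_succ hn i j (Or.inr h))
    · exact Or.inr (linked_of_succ hn j i (Or.inr h))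
  · exact Or.inl ⟨(if_neg hij).trans (if_neg h), commuting_of_ne hn i j hij h⟩

/-- The action of the Coxeter monoid of `D_n` on `D_n` by Demazure products. -/
noncomputable def starHom (hn : 2 ≤ n) :
    CoxeterMonoid (coxeterMatrix n) →* Function.End (EvenSignedPerm n) :=
  PresentedMonoid.lift (M := Function.End (EvenSignedPerm n))
    (rels := CoxeterMonoidRel (coxeterMatrix n)) (act hn) (by
    rintro _ _ (i | ⟨i, j, hij⟩)
    · funext u
      exact act_act hn i u
    · rcases coxeterMatrix_cases hn i j hij with ⟨h, hc⟩ | ⟨h, hl | hl⟩ <;> rw [h] <;> funext u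
      · exact hc.act_comm u
      · exact (hl.act_braid u).symm
      · exact hl.act_braid u)

theorem starProd_cons {ι : Type*} (M : CoxeterMatrix ι) (i : ι) (l : List ι) :
    starProd M (i :: l) = starProd M [i] * starProd M l := rfl

theorem starProd_idem {ι : Type*} (M : CoxeterMatrix ι) (i : ι) :
    starProd M [i] * starProd M [i] = starProd M [i] :=
  PresentedMonoid.mk_eq_mk_of_rel (CoxeterMonoidRel.idem i)

theorem starProd_braid {ι : Type*} (M : CoxeterMatrix ι) (i j : ι) (h : i ≠ j) :
    starProd M (CoxeterSystem.alternatingWord i j (M i j)) =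
      starProd M (CoxeterSystem.alternatingWord j i (M i j)) :=
  PresentedMonoid.mk_eq_mk_of_rel (CoxeterMonoidRel.braid i j h)

theorem starHom_starProd (hn : 2 ≤ n) (l : List (Fin n)) (u : EvenSignedPerm n) :
    starHom hn (starProd (coxeterMatrix n) l) u = l.foldr (act hn) u := by
  induction l with
  | nil => rfl
  | cons i l ih =>
    rw [starProd_cons, map_mul, List.foldr_cons, ← ih]
    rfl

/-! ### Reduced words -/

/-- `l` is a word for `u` whose length is the Coxeter length of `u`. -/
def Reduced (hn : 2 ≤ n) (l : List (Fin n)) (u : EvenSignedPerm n) : Prop :=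
  (l.map (simpleReflection hn)).prod = u ∧ 2 * l.length = invCount u

theorem invCount_simpleReflection_mul_le (hn : 2 ≤ n) (i : Fin n) (u : EvenSignedPerm n) :
    invCount (simpleReflection hn i * u) ≤ invCount u + 2 := by
  by_cases h : Desc hn i u
  · have := invCount_of_desc hn i u h
    omega
  · exact (invCount_of_not_desc hn i u h).le

theorem invCount_prod_le (hn : 2 ≤ n) (l : List (Fin n)) :
    invCount (l.map (simpleReflection hn)).prod ≤ 2 * l.length := by
  induction l with
  | nil => simp [invCount_one]
  | cons i l ih =>
    have := invCount_simpleReflection_mul_le hn i (l.map (simpleReflection hn)).prod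
    simp only [List.map_cons, List.prod_cons, List.length_cons]
    omega

theorem Reduced.cons {hn : 2 ≤ n} {i : Fin n} {l : List (Fin n)} {u : EvenSignedPerm n}
    (hi : Desc hn i u) (h : Reduced hn l (simpleReflection hn i * u)) :
    Reduced hn (i :: l) u := by
  refine ⟨?_, ?_⟩
  · rw [List.map_cons, List.prod_cons, h.1, simpleReflection_mul_cancel]
  · have := invCount_of_desc hn i u hi
    have := h.2
    simp only [List.length_cons]
    omega

/-- If `i` were not a descent, `s_i u` would be longer than `u`, while the tail is a shorter word
for it. -/
theorem Reduced.of_cons {hn : 2 ≤ n} {i : Fin n} {l : List (Fin n)} {u : EvenSignedPerm n}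
    (h : Reduced hn (i :: l) u) : Desc hn i u ∧ Reduced hn l (simpleReflection hn i * u) := by
  obtain ⟨h1, h2⟩ := h
  rw [List.map_cons, List.prod_cons] at h1
  have h3 : (l.map (simpleReflection hn)).prod = simpleReflection hn i * u := by
    rw [← h1, simpleReflection_mul_cancel]
  have h4 := invCount_prod_le hn l
  rw [h3] at h4
  rw [List.length_cons] at h2
  have hd : Desc hn i u := by
    by_contra hd
    have := invCount_of_not_desc hn i u hd
    omega
  refine ⟨hd, h3, ?_⟩
  have := invCount_of_desc hn i u hd
  omega

theorem exists_reduced (hn : 2 ≤ n) (u : EvenSignedPerm n) : ∃ l, Reduced hn l u := by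
  induction h : invCount u using Nat.strong_induction_on generalizing u with
  | _ N ih =>
    by_cases hu : u = 1
    · exact ⟨[], hu.symm, by rw [hu, invCount_one]; rfl⟩
    · have : ∃ i, Desc hn i u := by
        by_contra hc
        exact hu (eq_one_of_no_desc hn u (not_exists.1 hc))
      obtain ⟨i, hi⟩ := this
      have h1 := invCount_of_desc hn i u hi
      obtain ⟨l, hl⟩ := ih _ (by omega) (simpleReflection hn i * u) rfl
      exact ⟨i :: l, hl.cons hi⟩

theorem isReducedExpr_iff (hn : 2 ≤ n) (l : List (Fin n)) (u : EvenSignedPerm n) :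
    IsReducedExpr (simpleReflection hn) l u ↔ Reduced hn l u := by
  constructor
  · rintro ⟨h1, h2⟩
    refine ⟨h1, ?_⟩
    obtain ⟨l', h3, h4⟩ := exists_reduced hn u
    have h5 := h2 l' h3
    have h6 := invCount_prod_le hn l
    rw [h1] at h6
    omega
  · rintro ⟨h1, h2⟩
    refine ⟨h1, fun l' h3 => ?_⟩
    have h6 := invCount_prod_le hn l'
    rw [h3] at h6
    omega

/-- Linked descents: `u` has a reduced word that begins with `i j i`. -/
theorem Linked.desc_desc {hn : 2 ≤ n} {i j : Fin n} (h : Linked hn i j) {u : EvenSignedPerm n}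
    (hi : Desc hn i u) (hj : Desc hn j u) :
    (Desc hn j (simpleReflection hn i * u) ∧
      Desc hn i (simpleReflection hn j * (simpleReflection hn i * u))) ∧
    (Desc hn i (simpleReflection hn j * u) ∧
      Desc hn j (simpleReflection hn i * (simpleReflection hn j * u))) := by
  obtain ⟨h1, h2, h3⟩ := h
  have e1 : refl hn i (lo hn i) = lo hn j := by rw [refl_lo, h1]
  have e2 : refl hn i (lo hn j) = lo hn i := by rw [← h1, refl_hi]
  have e3 : refl hn j (lo hn j) = TypeD.hi hn j := refl_lo _ _
  have e4 : refl hn j (TypeD.hi hn j) = lo hn j := refl_hi _ _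
  simp only [Desc, h1, loc_simpleReflection_mul, h2, h3, e1, e2, e3, e4] at hi hj ⊢
  exact ⟨⟨hj.trans hi, hj⟩, ⟨hj.trans hi, hi⟩⟩

/-- Matsumoto's theorem: a reduced word is determined by its product, as an element of the Coxeter
monoid. -/
theorem starProd_eq_of_reduced (hn : 2 ≤ n) {c d : List (Fin n)} {u : EvenSignedPerm n}
    (hc : Reduced hn c u) (hd : Reduced hn d u) :
    starProd (coxeterMatrix n) c = starProd (coxeterMatrix n) d := by
  induction hN : c.length using Nat.strong_induction_on generalizing c d u with
  | _ N ih =>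
  have hlen : c.length = d.length := by
    have := hc.2
    have := hd.2
    omega
  match c, d, hlen with
  | [], [], _ => rfl
  | i :: c, j :: d, hlen =>
    obtain ⟨hi, hc'⟩ := hc.of_cons
    obtain ⟨hj, hd'⟩ := hd.of_cons
    simp only [List.length_cons] at hN hlen
    by_cases hij : i = j
    · subst hij
      rw [starProd_cons, starProd_cons _ i d, ih c.length (by omega) hc' hd' rfl]
    -- Both `i` and `j` are descents of `u`, so `u` has reduced words starting with either side of
    -- the braid relation and ending in a common word `e`. The induction hypothesis identifies `c`
    -- and `d` with the tails of these words.
    have braid := starProd_braid (coxeterMatrix n) i j hij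
    rcases coxeterMatrix_cases hn i j hij with ⟨hM, h1, h2, h3⟩ | ⟨hM, hl⟩ <;> rw [hM] at braid
    · have hji : Desc hn j (simpleReflection hn i * u) := (h3 u).2 hj
      have hij' : Desc hn i (simpleReflection hn j * u) := (h2 u).2 hi
      obtain ⟨e, he⟩ := exists_reduced hn (simpleReflection hn j * (simpleReflection hn i * u))
      have he' : Reduced hn e (simpleReflection hn i * (simpleReflection hn j * u)) := by
        rwa [← mul_assoc, h1, mul_assoc]
      have A := ih c.length (by omega) hc' (he.cons hji) rfl
      have B := ih d.length (by omega) hd' (he'.cons hij') rfl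
      rw [starProd_cons, A, starProd_cons _ j d, B]
      exact congrArg (· * starProd (coxeterMatrix n) e) braid
    · obtain ⟨br, ⟨d1, d2⟩, ⟨d3, d4⟩⟩ :
          (simpleReflection hn i * simpleReflection hn j * simpleReflection hn i =
            simpleReflection hn j * simpleReflection hn i * simpleReflection hn j) ∧
          (Desc hn j (simpleReflection hn i * u) ∧
            Desc hn i (simpleReflection hn j * (simpleReflection hn i * u))) ∧
          (Desc hn i (simpleReflection hn j * u) ∧
            Desc hn j (simpleReflection hn i * (simpleReflection hn j * u))) := by
        rcases hl with hl | hl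
        · exact ⟨hl.braid, hl.desc_desc hi hj⟩
        · exact ⟨hl.braid.symm, (hl.desc_desc hj hi).symm⟩
      obtain ⟨e, he⟩ := exists_reduced hn
        (simpleReflection hn i * (simpleReflection hn j * (simpleReflection hn i * u)))
      have he' : Reduced hn e
          (simpleReflection hn j * (simpleReflection hn i * (simpleReflection hn j * u))) := by
        rwa [← mul_assoc, ← mul_assoc, ← br, mul_assoc, mul_assoc]
      have A := ih c.length (by omega) hc' ((he.cons d2).cons d1) rfl
      have B := ih d.length (by omega) hd' ((he'.cons d4).cons d3) rfl
      rw [starProd_cons, A, starProd_cons _ j d, B]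
      exact congrArg (· * starProd (coxeterMatrix n) e) braid.symm

theorem starProd_mul_of_desc (hn : 2 ≤ n) {i : Fin n} {c : List (Fin n)} {u : EvenSignedPerm n}
    (hi : Desc hn i u) (hc : Reduced hn c u) :
    starProd (coxeterMatrix n) [i] * starProd (coxeterMatrix n) c =
      starProd (coxeterMatrix n) c := by
  obtain ⟨e, he⟩ := exists_reduced hn (simpleReflection hn i * u)
  rw [starProd_eq_of_reduced hn hc (he.cons hi), starProd_cons _ i e, ← mul_assoc, starProd_idem]

/-- Left multiplication by a generator in the monoid matches `act` on the group: a descent is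
absorbed by idempotence, a non-descent lengthens the reduced word. This gives existence of the
Demazure product. -/
theorem exists_starProd_eq (hn : 2 ≤ n) (a b : List (Fin n)) (v : EvenSignedPerm n)
    (hb : Reduced hn b v) : ∃ c, Reduced hn c (a.foldr (act hn) v) ∧
      starProd (coxeterMatrix n) a * starProd (coxeterMatrix n) b =
        starProd (coxeterMatrix n) c := by
  induction a with
  | nil => exact ⟨b, hb, one_mul _⟩
  | cons i a ih =>
    obtain ⟨c, hc, h⟩ := ih
    rw [starProd_cons, mul_assoc, h, List.foldr_cons]
    by_cases hd : Desc hn i (a.foldr (act hn) v)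
    · rw [act_of_desc hd]
      exact ⟨c, hc, starProd_mul_of_desc hn hd hc⟩
    · rw [act_of_not_desc hd]
      refine ⟨i :: c, ?_, rfl⟩
      apply Reduced.cons ((desc_simpleReflection_mul hn i _).2 hd)
      rwa [simpleReflection_mul_cancel]

/-- Acting on `1` recovers a group element from its image in the monoid, which gives uniqueness of
the Demazure product. -/
theorem foldr_act_one (hn : 2 ≤ n) {l : List (Fin n)} {u : EvenSignedPerm n}
    (h : Reduced hn l u) : l.foldr (act hn) 1 = u := by
  induction l generalizing u with
  | nil => exact h.1
  | cons i l ih =>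
    obtain ⟨hd, hl⟩ := h.of_cons
    rw [List.foldr_cons, ih hl, act_of_not_desc, simpleReflection_mul_cancel]
    rw [desc_simpleReflection_mul]
    exact not_not.2 hd

/-- The Demazure product `w ⋆ v` is computed by the action of a reduced word for `w`. -/
theorem demazureD_eq (hn : 2 ≤ n) {a : List (Fin n)} {w : EvenSignedPerm n}
    (ha : Reduced hn a w) (v : EvenSignedPerm n) :
    demazureD hn w v = a.foldr (act hn) v := by
  have hex : ∃ u, IsDemazureProduct (coxeterMatrix n) (simpleReflection hn) w v u := by
    obtain ⟨b, hb⟩ := exists_reduced hn v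
    obtain ⟨c, hc, h⟩ := exists_starProd_eq hn a b v hb
    exact ⟨_, a, b, c, (isReducedExpr_iff hn _ _).2 ha, (isReducedExpr_iff hn _ _).2 hb,
      (isReducedExpr_iff hn _ _).2 hc, h⟩
  obtain ⟨a', b, c, ha', hb, hc, h⟩ := Classical.epsilon_spec hex
  rw [isReducedExpr_iff] at ha' hb hc
  change Reduced hn c (demazureD hn w v) at hc
  rw [starProd_eq_of_reduced hn ha' ha] at h
  have h1 : starHom hn (starProd _ a) (starHom hn (starProd _ b) 1) =
      starHom hn (starProd _ c) 1 := by
    rw [← h, map_mul]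
    rfl
  rw [starHom_starProd, starHom_starProd, starHom_starProd, foldr_act_one hn hb,
    foldr_act_one hn hc] at h1
  exact h1.symm

theorem demazureD_one (hn : 2 ≤ n) (v : EvenSignedPerm n) : demazureD hn 1 v = v :=
  demazureD_eq hn (a := []) ⟨rfl, invCount_one.symm⟩ v

/-- Appending `i` to a reduced word of `w s_i` gives a reduced word of `w`, whose last letter acts
on `v` first. -/
theorem demazureD_of_desc_inv (hn : 2 ≤ n) {i : Fin n} {w : EvenSignedPerm n}
    (h : Desc hn i w⁻¹) (v : EvenSignedPerm n) :
    demazureD hn w v = demazureD hn (w * simpleReflection hn i) (act hn i v) := by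
  obtain ⟨a, ha⟩ := exists_reduced hn (w * simpleReflection hn i)
  have h1 : Reduced hn (a ++ [i]) w := by
    refine ⟨?_, ?_⟩
    · rw [List.map_append, List.prod_append, ha.1, List.map_singleton, List.prod_singleton,
        mul_assoc, simpleReflection_mul_self, mul_one]
    · have h2 := invCount_of_desc hn i _ h
      have h3 : (w * simpleReflection hn i)⁻¹ = simpleReflection hn i * w⁻¹ := by
        rw [mul_inv_rev, inv_eq_of_mul_eq_one_left (simpleReflection_mul_self hn i)]
      rw [← h3, invCount_inv, invCount_inv] at h2
      have h4 := ha.2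
      rw [List.length_append, List.length_singleton]
      omega
  rw [demazureD_eq hn h1, demazureD_eq hn ha, List.foldr_append]
  rfl

end Demazure

/-! ### Hopping -/

section Hopping

variable {n : ℕ}

/-- `q` is a letter with which the hopping operator `h_{t, w ↖ t}` may exchange `t` in `u`. -/
def Hoppable (t : Letter n) (w u : SignedPerm n) (q : Letter n) : Prop :=
  t < q ∧ q < t.rev ∧ loc w q < loc w t ∧ loc u t < loc u q

/-- This translates subwords of the unfolding into inequalities of positions, the only form in which
they are used later. -/
theorem mem_takeWhile_ofFn (w : SignedPerm n) (t x : Letter n) :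
    x ∈ (unfolding w).takeWhile (fun y => decide (y ≠ t)) ↔ loc w x < loc w t := by
  have hidx : (unfolding w).takeWhile (fun y => decide (y ≠ t)) =
      (unfolding w).take (loc w t) := by
    have hlen : (unfolding w).length = 2 * n := by simp [unfolding]
    rw [List.takeWhile_eq_take_findIdx_not]
    congr 1
    rw [List.findIdx_eq (by rw [hlen]; exact (loc w t).2)]
    simp only [unfolding, List.getElem_ofFn]
    refine ⟨by simp [apply_loc], fun j hj => ?_⟩
    simp only [ne_eq, decide_not, Bool.not_not, decide_eq_false_iff_not]
    intro e
    have h2 := congrArg (loc w) e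
    rw [loc_apply] at h2
    exact hj.ne (congrArg Fin.val h2)
  rw [hidx, List.mem_take_iff_getElem]
  simp only [unfolding, List.getElem_ofFn, List.length_ofFn]
  constructor
  · rintro ⟨i, hi, rfl⟩
    rw [loc_apply, Fin.lt_def]
    simp only
    omega
  · intro h
    exact ⟨loc w x, by rw [Fin.lt_def] at h; omega, apply_loc w x⟩

theorem mem_lifting (w : SignedPerm n) (t x : Letter n) :
    x ∈ lifting w t ↔ loc w x < loc w t ∧ t < x ∧ x < t.rev := by
  rw [lifting, List.mem_filter, mem_takeWhile_ofFn]
  simp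

theorem pairwise_lifting (w : SignedPerm n) (t : Letter n) :
    (lifting w t).Pairwise fun x y => loc w x < loc w y := by
  have h : (unfolding w).Pairwise fun x y => loc w x < loc w y := by
    rw [unfolding, List.pairwise_ofFn]
    intro i j hij
    rwa [loc_apply, loc_apply]
  exact (h.sublist (List.takeWhile_sublist _)).sublist List.filter_sublist

theorem rel_getLast?_of_pairwise {α : Type*} {r : α → α → Prop} {l : List α} (h : l.Pairwise r)
    {q : α} (hq : l.getLast? = some q) {x : α} (hx : x ∈ l) : x = q ∨ r x q := by
  obtain ⟨l', rfl⟩ := List.getLast?_eq_some_iff.1 hq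
  rw [List.pairwise_append] at h
  rcases List.mem_append.1 hx with h1 | h1
  · exact Or.inr (h.2.2 x h1 q (by simp))
  · exact Or.inl (by simpa using h1)

theorem hopTarget_lifting_none {t : Letter n} {w u : SignedPerm n}
    (h : hopTarget t (lifting w t) u = none) (x : Letter n) : ¬ Hoppable t w u x := by
  rintro ⟨h1, h2, h3, h4⟩
  rw [hopTarget, List.getLast?_eq_none_iff, List.filter_eq_nil_iff] at h
  have := h x ((mem_lifting w t x).2 ⟨h3, h1, h2⟩)
  simp only [decide_eq_true_eq, not_and] at this
  exact this h1 h4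

theorem hopTarget_lifting_some {t : Letter n} {w u : SignedPerm n} {q : Letter n}
    (h : hopTarget t (lifting w t) u = some q) :
    Hoppable t w u q ∧ ∀ x, Hoppable t w u x → loc w x ≤ loc w q := by
  rw [hopTarget] at h
  constructor
  · have h1 := List.mem_filter.1 (List.mem_of_getLast? h)
    have h2 := (mem_lifting w t q).1 h1.1
    have h3 := h1.2
    simp only [decide_eq_true_eq] at h3
    exact ⟨h2.2.1, h2.2.2, h2.1, h3.2⟩
  · rintro x ⟨h1, h2, h3, h4⟩
    have hx : x ∈ (lifting w t).filter fun q => t < q ∧ u.1⁻¹ t < u.1⁻¹ q := by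
      rw [List.mem_filter, mem_lifting]
      refine ⟨⟨h3, h1, h2⟩, ?_⟩
      simp only [decide_eq_true_eq]
      exact ⟨h1, h4⟩
    rcases rel_getLast?_of_pairwise ((pairwise_lifting w t).sublist List.filter_sublist) h hx
      with rfl | h5
    · exact le_rfl
    · exact h5.le

theorem hopTarget_lifting_eq {t : Letter n} {w u : SignedPerm n} {q : Letter n}
    (h : Hoppable t w u q) (hmax : ∀ x, Hoppable t w u x → x ≠ q → loc w x < loc w q) :
    hopTarget t (lifting w t) u = some q := by
  cases hc : hopTarget t (lifting w t) u with
  | none => exact absurd h (hopTarget_lifting_none hc q)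
  | some r =>
    obtain ⟨h1, h2⟩ := hopTarget_lifting_some hc
    by_contra hne
    have hr : r ≠ q := fun e => hne (by rw [e])
    exact absurd (h2 q h) (not_le.2 (hmax r h1 hr))

theorem hop_of_none {t : Letter n} {L : List (Letter n)} {u : SignedPerm n}
    (h : hopTarget t L u = none) : hop t L u = u := by
  rw [hop]
  split
  · rfl
  · rename_i q hq
    rw [h] at hq
    cases hq

theorem hop_of_some {t : Letter n} {L : List (Letter n)} {u : SignedPerm n} {q : Letter n}
    (h : hopTarget t L u = some q) : hop t L u = hop t L (signedSwap t q * u) := by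
  rw [hop]
  split
  · rename_i hq
    rw [h] at hq
    cases hq
  · rename_i r hq
    rw [h] at hq
    cases hq
    rfl

/-! ### Dependence of the hopping operator on its list -/

/-- A hop moves no letter from the left to the right of `t`. -/
theorem loc_lt_of_hoppable {t : Letter n} {w u : SignedPerm n} {q x : Letter n}
    (h : Hoppable t w u q) (h1 : t < x) (h2 : x < t.rev) (hx : loc u x < loc u t) :
    loc (signedSwap t q * u) x < loc (signedSwap t q * u) t := by
  obtain ⟨a, b, -, c⟩ := h
  rw [loc_signedSwap_mul b.ne, loc_signedSwap_mul b.ne, if_pos rfl, if_neg h1.ne']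
  by_cases e1 : x = q
  · rwa [e1, if_pos rfl, ← e1] at *
  rw [if_neg e1, if_neg h2.ne]
  by_cases e2 : x = q.rev
  -- The letter `-q` moves to the mirror image of the old position of `t`; reflecting the hypothesis
  -- gives the claim.
  · rw [if_pos e2]
    rw [e2, loc_rev] at hx
    rw [Fin.lt_def, Fin.val_rev] at hx ⊢
    omega
  · rw [if_neg e2]
    exact hx.trans c

/-- If `-q` is to the right of `t`, then it is still to the right of `t` after `t` has
been exchanged with `q`. -/
theorem lt_loc_rev_of_hoppable {t q : Letter n} {u : SignedPerm n} (h1 : t < q) (h2 : q < t.rev)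
    (hr : loc u t < loc u q.rev) :
    loc (signedSwap t q * u) t < loc (signedSwap t q * u) q.rev := by
  have e1 : q.rev ≠ t := fun e => h2.ne (by rw [← e, Fin.rev_rev])
  have e2 : q.rev ≠ q := by
    rw [ne_eq, Fin.ext_iff, Fin.val_rev]
    omega
  have e3 : q.rev ≠ t.rev := fun e => h1.ne' (Fin.rev_injective e)
  rw [loc_signedSwap_mul h2.ne, loc_signedSwap_mul h2.ne, if_pos rfl, if_neg e1, if_neg e2,
    if_neg e3, if_pos rfl]
  rw [loc_rev] at hr
  rw [Fin.lt_def, Fin.val_rev] at *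
  omega

/-- Conjugation by the exchange of `t` and `-q` turns the pair `t, q` into `-q, -t`, which defines
the same reflection. -/
theorem signedSwap_mul_signedSwap_rev {t q : Letter n} (h1 : t < q) (h2 : q < t.rev)
    (u : SignedPerm n) : signedSwap t q.rev * (signedSwap t q * u) =
      signedSwap t q * (signedSwap t q.rev * u) := by
  have h3 : q.rev ≠ t.rev := fun e => h1.ne' (Fin.rev_injective e)
  have h4 : q ≠ q.rev := by
    rw [ne_eq, Fin.ext_iff, Fin.val_rev]
    omega
  have hm := mul_signedSwap h2.ne (signedSwap t q.rev)
  rw [signedSwap_apply h3, signedSwap_apply h3, if_pos rfl, if_neg h1.ne', if_neg h4,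
    if_neg h2.ne, Fin.rev_rev, if_pos rfl, signedSwap_rev_rev h2.ne] at hm
  rw [← mul_assoc, ← mul_assoc, hm]

/-- The second of two hops that exchange `t` with `q` and `-q`. -/
theorem hopTarget_rev_of_hoppable {t : Letter n} {w w' u : SignedPerm n} {q : Letter n}
    (hord : ∀ x y, t < x → x < t.rev → t < y → y < t.rev → y ≠ x → y ≠ x.rev →
      loc w' x < loc w' y → loc w x < loc w y)
    (hmem : ∀ x, Hoppable t w u x ↔ Hoppable t w' u x)
    (hq : Hoppable t w u q) (hr : Hoppable t w' u q.rev)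
    (hmax : ∀ x, Hoppable t w' u x → loc w' x ≤ loc w' q.rev) :
    hopTarget t (lifting w t) (signedSwap t q * u) = some q.rev := by
  have hr' := (hmem _).2 hr
  apply hopTarget_lifting_eq
  · exact ⟨hr.1, hr.2.1, hr'.2.2.1, lt_loc_rev_of_hoppable hq.1 hq.2.1 hr.2.2.2⟩
  · intro x hx hne
    obtain ⟨x1, x2, x3, x4⟩ := hx
    have hxq : x ≠ q := by
      rintro rfl
      rw [loc_signedSwap_mul hq.2.1.ne, loc_signedSwap_mul hq.2.1.ne, if_pos rfl,
        if_neg x1.ne', if_pos rfl] at x4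
      exact lt_asymm x4 hq.2.2.2
    rw [loc_signedSwap_mul hq.2.1.ne, loc_signedSwap_mul hq.2.1.ne, if_pos rfl,
        if_neg x1.ne', if_neg hxq, if_neg x2.ne, if_neg hne] at x4
    -- A candidate other than `q` and `-q` has not moved, so it was a candidate before the hop.
    -- There `w'` places it before `-q`, and `w` agrees because the two are not opposite.
    have hx' := (hmem x).1 ⟨x1, x2, x3, hq.2.2.2.trans x4⟩
    apply hord x q.rev x1 x2 hr.1 hr.2.1 hne.symm
    · rw [ne_eq, Fin.rev_inj]
      exact hxq.symm
    · exact lt_of_le_of_ne (hmax x hx') fun e => hne (loc_injective _ e)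

/-- The operator `h_{t, w ↖ t}` depends on `w` only through the order of the letters that are not
opposite to each other, and letters to the left of `t` may be added to the list. -/
theorem hop_lifting_congr {t : Letter n} {w w' : SignedPerm n}
    (hord : ∀ x y, t < x → x < t.rev → t < y → y < t.rev → y ≠ x → y ≠ x.rev →
      (loc w' x < loc w' y ↔ loc w x < loc w y)) (u : SignedPerm n)
    (hu : ∀ x, t < x → x < t.rev →
      (loc w x < loc w t ↔ loc w' x < loc w' t) ∨ loc u x < loc u t) :
    hop t (lifting w t) u = hop t (lifting w' t) u := by
  -- Every hop moves `t` to the right.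
  induction hN : 2 * n - (loc u t : ℕ) using Nat.strong_induction_on generalizing u with
  | _ N ih =>
  -- A letter on whose membership the two lists disagree is to the left of `t` in `u`, hence no
  -- candidate for either.
  have hmem : ∀ x, Hoppable t w u x ↔ Hoppable t w' u x := by
    intro x
    constructor <;> rintro ⟨h1, h2, h3, h4⟩ <;> refine ⟨h1, h2, ?_, h4⟩ <;>
      rcases hu x h1 h2 with h | h
    · exact h.1 h3
    · exact absurd h h4.not_gt
    · exact h.2 h3
    · exact absurd h h4.not_gt
  have next : ∀ (q : Letter n) (v : SignedPerm n), Hoppable t w v q →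
      (∀ x, t < x → x < t.rev →
        (loc w x < loc w t ↔ loc w' x < loc w' t) ∨ loc v x < loc v t) →
      ∀ x, t < x → x < t.rev → (loc w x < loc w t ↔ loc w' x < loc w' t) ∨
        loc (signedSwap t q * v) x < loc (signedSwap t q * v) t :=
    fun q v hq hv x h1 h2 => (hv x h1 h2).imp id (loc_lt_of_hoppable hq h1 h2)
  have grow : ∀ (q : Letter n) (v : SignedPerm n), Hoppable t w v q →
      loc v t < loc (signedSwap t q * v) t := fun q v hq => by
    rw [loc_signedSwap_mul hq.2.1.ne, if_pos rfl]
    exact hq.2.2.2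
  cases h : hopTarget t (lifting w t) u with
  | none =>
    cases h' : hopTarget t (lifting w' t) u with
    | none => rw [hop_of_none h, hop_of_none h']
    | some q => exact absurd ((hmem q).2 (hopTarget_lifting_some h').1) (hopTarget_lifting_none h q)
  | some q =>
    obtain ⟨hq, hmax⟩ := hopTarget_lifting_some h
    cases h' : hopTarget t (lifting w' t) u with
    | none => exact absurd ((hmem q).1 hq) (hopTarget_lifting_none h' q)
    | some r =>
      obtain ⟨hr, hmax'⟩ := hopTarget_lifting_some h'
      have g1 := grow q u hq
      by_cases hqr : r = q
      · subst hqr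
        rw [hop_of_some h, hop_of_some h']
        refine ih _ ?_ _ (next r u hq hu) rfl
        rw [Fin.lt_def] at g1
        omega
      -- Each target is last among the same candidates, for `w` and for `w'`; these orders can
      -- disagree only on opposite letters.
      have hrev : r = q.rev := by
        by_contra hne
        have h1 := hmax r ((hmem r).2 hr)
        have h2 := lt_of_le_of_ne (hmax' q ((hmem q).1 hq)) fun e =>
          hqr (loc_injective _ e).symm
        exact absurd ((hord q r hq.1 hq.2.1 hr.1 hr.2.1 hqr hne).1 h2) h1.not_gt
      subst hrev
      have t1 := hopTarget_rev_of_hoppable (fun x y a b c d e f => (hord x y a b c d e f).1)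
        hmem hq hr hmax'
      have t2 := hopTarget_rev_of_hoppable (q := q.rev)
        (fun x y a b c d e f => (hord x y a b c d e f).2) (fun x => (hmem x).symm) hr
        (by rwa [Fin.rev_rev]) (by rwa [Fin.rev_rev])
      rw [Fin.rev_rev] at t2
      -- One side hops over `q` then `-q`, the other over `-q` then `q`; after two hops they
      -- coincide.
      rw [hop_of_some h, hop_of_some h', hop_of_some t1, hop_of_some t2,
        ← signedSwap_mul_signedSwap_rev hq.1 hq.2.1]
      have hr2 := (hopTarget_lifting_some t1).1
      have g2 := grow _ _ hr2
      refine ih _ ?_ _ (next _ _ hr2 (next q u hq hu)) rfl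
      rw [Fin.lt_def] at g1 g2
      omega

theorem hop_eq_self {t : Letter n} {w u : SignedPerm n} (h : ∀ x, ¬ Hoppable t w u x) :
    hop t (lifting w t) u = u := by
  cases hc : hopTarget t (lifting w t) u with
  | none => exact hop_of_none hc
  | some q => exact absurd (hopTarget_lifting_some hc).1 (h q)

end Hopping

/-! ### The Demazure product by hopping -/

section Main

variable {n : ℕ}

theorem signedSwap_comm {a b : Letter n} (h : b ≠ a.rev) : signedSwap a b = signedSwap b a := by
  have h' : a ≠ b.rev := fun e => h (by rw [e, Fin.rev_rev])
  apply Subtype.ext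
  ext x
  rw [signedSwap_apply h, signedSwap_apply h']
  simp only [Fin.ext_iff, Fin.val_rev, apply_ite Fin.val, ne_eq] at h ⊢
  split_ifs <;> omega

/-- A position `p` beyond `k` can be lowered by a simple reflection that fixes all positions before
`k`. -/
theorem exists_lowering (hn : 2 ≤ n) {k : ℕ} (hk : k + 1 < n) (p : Letter n) (h1 : k < p)
    (h2 : (p : ℕ) + k + 1 ≤ 2 * n) : ∃ (i : Fin n) (p' : Letter n),
      ((p = hi hn i ∧ p' = lo hn i) ∨ (p = (lo hn i).rev ∧ p' = (hi hn i).rev)) ∧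
      p' < p ∧ k ≤ p' ∧ (∀ a, a < p → a ≠ p.rev → a ≤ p') ∧
      ∀ x : Letter n, (x : ℕ) < k → refl hn i x = x := by
  -- In the left half and in the right half the preceding position is used. Just past the middle,
  -- the preceding position is opposite to `p`, and `s_n` skips it.
  rcases lt_trichotomy (p : ℕ) n with h | h | h
  · have e : (p : ℕ) - 1 + 1 < n := by omega
    refine ⟨⟨p - 1, by omega⟩, ⟨p - 1, by omega⟩, Or.inl ⟨?_, ?_⟩, ?_, ?_, ?_, ?_⟩
    · ext
      simp only [hi, e, if_true]
      omega
    · ext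
      simp only [lo, e, if_true]
    · rw [Fin.lt_def]
      simp only
      omega
    · simp only
      omega
    · intro a ha _
      rw [Fin.lt_def] at ha
      rw [Fin.le_def]
      simp only
      omega
    · intro x hx
      ext
      rw [refl_val]
      simp only [e, if_true]
      split_ifs <;> omega
  · have e : ¬ n - 1 + 1 < n := by omega
    refine ⟨⟨n - 1, by omega⟩, ⟨n - 2, by omega⟩, Or.inl ⟨?_, ?_⟩, ?_, ?_, ?_, ?_⟩
    · ext
      simp only [hi, e, if_false]
      omega
    · ext
      simp only [lo, e, if_false]
    · rw [Fin.lt_def]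
      simp only
      omega
    · simp only
      omega
    · intro a ha ha'
      rw [Fin.lt_def] at ha
      rw [ne_eq, Fin.ext_iff, Fin.val_rev] at ha'
      rw [Fin.le_def]
      simp only
      omega
    · intro x hx
      ext
      rw [refl_val]
      simp only [e, if_false]
      split_ifs <;> omega
  · have e : 2 * n - 1 - (p : ℕ) + 1 < n := by omega
    have hp := p.2
    refine ⟨⟨2 * n - 1 - p, by omega⟩, ⟨p - 1, by omega⟩, Or.inr ⟨?_, ?_⟩, ?_, ?_, ?_, ?_⟩
    · ext
      simp only [lo, e, if_true, Fin.val_rev]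
      omega
    · ext
      simp only [hi, e, if_true, Fin.val_rev]
      omega
    · rw [Fin.lt_def]
      simp only
      omega
    · simp only
      omega
    · intro a ha _
      rw [Fin.lt_def] at ha
      rw [Fin.le_def]
      simp only
      omega
    · intro x hx
      ext
      rw [refl_val]
      simp only [e, if_true]
      split_ifs <;> omega

/-- If `w` fixes the letters before `t` but not `t`, then there is a right descent `i` of `w` such
that `w` and `w s_i` differ by the exchange of `t` with the last letter of `w ↖ t`. -/
theorem exists_right_descent (hn : 2 ≤ n) (w : EvenSignedPerm n) (t : Letter n)
    (ht : (t : ℕ) + 1 < n) (hfix : ∀ x, x < t → loc w.1 x = x) (hne : loc w.1 t ≠ t) :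
    ∃ (i : Fin n) (q : Letter n), Desc hn i w⁻¹ ∧
      (w * simpleReflection hn i).1 = signedSwap t q * w.1 ∧ t < q ∧ q < t.rev ∧
      loc w.1 q < loc w.1 t ∧
      (∀ x, x < t → loc (w * simpleReflection hn i).1 x = x) ∧
      (∀ x, loc w.1 x < loc w.1 t → x ≠ t.rev → loc w.1 x ≤ loc w.1 q) ∧
      (∀ v : EvenSignedPerm n, Desc hn i v ↔ loc (w * v).1 t < loc (w * v).1 q) ∧
      ∀ x y, y ≠ x.rev → ¬ (x = q ∧ y = t) → ¬ (x = t.rev ∧ y = q.rev) →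
        loc w.1 x < loc w.1 y →
          loc (w * simpleReflection hn i).1 x < loc (w * simpleReflection hn i).1 y := by
  -- The fixed letters fill all positions before `t`. Applied to `t` and `-t`, this bounds the
  -- position of `t` on both sides.
  have hlow : ∀ x, ¬ x < t → ¬ loc w.1 x < t := fun x hx h =>
    hx (by rwa [← loc_injective _ (hfix _ h)])
  have hlow' : ∀ p : Letter n, ¬ p < t → ¬ w.1.1 p < t := fun p hp h => by
    have := hfix _ h
    rw [loc_apply] at this
    exact hp (this ▸ h)
  have h1 : (t : ℕ) < loc w.1 t := by
    have := hlow t (lt_irrefl t)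
    rw [Fin.lt_def] at this
    rw [ne_eq, Fin.ext_iff] at hne
    omega
  have h2 : (loc w.1 t : ℕ) + t + 1 ≤ 2 * n := by
    have := hlow t.rev (by rw [Fin.lt_def, Fin.val_rev]; omega)
    rw [loc_rev, Fin.lt_def, Fin.val_rev] at this
    omega
  obtain ⟨i, p', hp, hlt, hk, hmax, hfix'⟩ := exists_lowering hn ht (loc w.1 t) h1 h2
  have hq : loc w.1 (w.1.1 p') = p' := loc_apply _ _
  generalize w.1.1 p' = q at hq
  subst hq
  have hrl := hi_ne_rev_lo hn i
  have hrr : loc w.1 q ≠ (loc w.1 t).rev := by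
    rcases hp with ⟨e1, e2⟩ | ⟨e1, e2⟩ <;> rw [e1, e2]
    · exact fun e => hrl (by rw [e, Fin.rev_rev])
    · rw [Fin.rev_rev]
      exact fun e => hrl (by rw [← e, Fin.rev_rev])
  have hqt : q ≠ t.rev := fun e => hrr (by rw [e, loc_rev])
  have htq : t < q := by
    have a1 : ¬ q < t := fun h => by
      have := hfix _ h
      rw [this] at hk
      exact absurd h (not_lt.2 hk)
    exact lt_of_le_of_ne (not_lt.1 a1) fun e => hlt.ne (by rw [e])
  have hqr : q < t.rev := by
    refine lt_of_le_of_ne (not_lt.1 fun h => ?_) hqt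
    have a1 : q.rev < t := by rwa [← Fin.rev_lt_rev, Fin.rev_rev]
    have a2 := hfix _ a1
    rw [loc_rev] at a2
    rw [Fin.ext_iff, Fin.val_rev, Fin.val_rev] at a2
    rw [Fin.lt_def, Fin.val_rev] at a1
    rw [Fin.lt_def] at hlt
    have := q.2
    omega
  have hw : ∀ x, w.1.1 (loc w.1 x) = x := apply_loc w.1
  have hwrev : ∀ x, w.1.1 x.rev = (w.1.1 x).rev := w.1.2
  -- The positions of `q` and `t` form the pair of `s_i` or its mirror image, according to the half
  -- in which `t` is lowered.
  have hval : w.1.1 (hi hn i) = t ∧ w.1.1 (lo hn i) = q ∨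
      w.1.1 (lo hn i) = t.rev ∧ w.1.1 (hi hn i) = q.rev := by
    rcases hp with ⟨e1, e2⟩ | ⟨e1, e2⟩
    · exact Or.inl ⟨by rw [← e1, hw], by rw [← e2, hw]⟩
    · refine Or.inr ⟨?_, ?_⟩
      · rw [← hw t, e1, hwrev, Fin.rev_rev]
      · rw [← hw q, e2, hwrev, Fin.rev_rev]
  refine ⟨i, q, ?_, ?_, htq, hqr, hlt, ?_, ?_, ?_, ?_⟩
  · change w.1.1 (hi hn i) < w.1.1 (lo hn i)
    rcases hval with ⟨e1, e2⟩ | ⟨e1, e2⟩ <;> rw [e1, e2]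
    · exact htq
    · rwa [Fin.rev_lt_rev]
  · rw [Subgroup.coe_mul, simpleReflection_eq, mul_signedSwap hrl]
    have c := signedSwap_comm (a := t) (b := q) hqt
    rcases hval with ⟨e1, e2⟩ | ⟨e1, e2⟩ <;> rw [e1, e2]
    · rw [c]
    · rw [signedSwap_rev_rev fun e => hqt (by rw [e, Fin.rev_rev]), c]
  · intro x hx
    rw [loc_mul_simpleReflection, hfix x hx, hfix' x hx]
  · intro x hx hxt
    exact hmax _ hx fun e => hxt (loc_injective w.1 (by rw [e, loc_rev]))
  · intro v
    have e : ∀ x, loc (w * v).1 x = loc v.1 (loc w.1 x) := loc_mul w.1 v.1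
    rw [e, e, Desc]
    rcases hp with ⟨e1, e2⟩ | ⟨e1, e2⟩ <;> rw [e1, e2]
    rw [loc_rev, loc_rev, Fin.rev_lt_rev]
  · intro x y hxy n1 n2 hlt'
    rw [loc_mul_simpleReflection, loc_mul_simpleReflection]
    apply refl_lt_refl hn i hlt'
    · rw [← loc_rev]
      exact fun e => hxy (loc_injective _ e)
    all_goals
      rintro ⟨e1, e2⟩
      replace e1 := congrArg w.1.1 e1
      replace e2 := congrArg w.1.1 e2
      rw [hw] at e1 e2
      rcases hval with ⟨e3, e4⟩ | ⟨e3, e4⟩ <;>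
        simp only [hwrev, e3, e4, Fin.rev_rev] at e1 e2 <;>
        first | exact n1 ⟨e1, e2⟩ | exact n2 ⟨e1, e2⟩

/-- One factor `h_{i, w ↖ i}` of `hopAll`. -/
def hopStep (w u : SignedPerm n) (i : Fin (n - 1)) : SignedPerm n :=
  hop (pos (i.castLE (Nat.sub_le n 1))) (lifting w (pos (i.castLE (Nat.sub_le n 1)))) u

/-- Allowing the first `k` letters to be fixed makes a double induction possible: on the number `d`
of remaining operators, and for each `k` on the position in `w` of the letter with code `k`. -/
theorem demazureD_eq_foldl (hn : 2 ≤ n) (d k : ℕ) (hd : k + d = n - 1) (w : EvenSignedPerm n)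
    (hfix : ∀ x : Letter n, (x : ℕ) < k → loc w.1 x = x) (v : EvenSignedPerm n) :
    (demazureD hn w v).1 =
      ((List.finRange (n - 1)).drop k).foldl (hopStep w.1) (w * v).1 := by
  induction d generalizing k w v with
  | zero =>
    have hw : w = 1 := eq_one_of_fixes w fun x hx => by
      have := hfix x (by omega)
      conv_lhs => rw [← this]
      exact apply_loc _ _
    rw [List.drop_of_length_le (by rw [List.length_finRange]; omega), hw, demazureD_one, one_mul]
    rfl
  | succ d ihd =>
    have hk : k < n - 1 := by omega
    have hdrop : (List.finRange (n - 1)).drop k =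
        ⟨k, hk⟩ :: (List.finRange (n - 1)).drop (k + 1) := by
      rw [List.drop_eq_getElem_cons (by rwa [List.length_finRange]), List.getElem_finRange]
      rfl
    rw [hdrop]
    set t : Letter n := ⟨k, by omega⟩ with ht
    have hstep : ∀ w u : SignedPerm n, hopStep w u ⟨k, hk⟩ = hop t (lifting w t) u :=
      fun w u => rfl
    simp only [List.foldl_cons, hstep]
    induction hN : (loc w.1 t : ℕ) using Nat.strong_induction_on generalizing w v with
    | _ N ihN =>
    by_cases hwt : loc w.1 t = t
    · rw [hop_eq_self]
      · apply ihd (k + 1) (by omega)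
        intro x hx
        by_cases hxk : (x : ℕ) = k
        · rwa [show x = t from Fin.ext hxk]
        · exact hfix x (by omega)
      -- If `t` is fixed, only smaller letters precede it in `w`, so nothing can be hopped over.
      · rintro x ⟨h1, -, h2, -⟩
        rw [hwt] at h2
        have h3 := hfix _ h2
        rw [loc_injective _ h3] at h2
        exact lt_asymm h1 h2
    obtain ⟨i, q, hdesc, hsw, htq, hqt, hlt, hfix', hmax, hdv, hord⟩ :=
      exists_right_descent hn w t (by simp only [ht]; omega) hfix hwt
    set w' := w * simpleReflection hn i with hw'
    have hqr : q ≠ t.rev := hqt.ne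
    have hloct : loc w'.1 t = loc w.1 q := by rw [hsw, loc_signedSwap_mul hqr, if_pos rfl]
    rw [demazureD_of_desc_inv hn hdesc v, ihN (loc w'.1 t) (by rw [hloct, ← hN]; exact hlt) w'
      hfix' (act hn i v) rfl]
    have hord' : ∀ x y, t < x → x < t.rev → t < y → y < t.rev → y ≠ x → y ≠ x.rev →
        (loc w'.1 x < loc w'.1 y ↔ loc w.1 x < loc w.1 y) := by
      intro x y x1 x2 y1 y2 hyx hyr
      have hxr : x ≠ y.rev := fun e => hyr (by rw [e, Fin.rev_rev])
      refine ⟨fun h => ?_, hord x y hyr (fun e => y1.ne' e.2) (fun e => x2.ne e.1)⟩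
      by_contra hc
      refine lt_asymm h (hord y x hxr (fun e => x1.ne' e.2) (fun e => y2.ne e.1) ?_)
      exact lt_of_le_of_ne (not_lt.1 hc) fun e => hyx (loc_injective _ e)
    have hmem : ∀ x, t < x → x < t.rev → x ≠ q →
        (loc w.1 x < loc w.1 t ↔ loc w'.1 x < loc w'.1 t) := by
      intro x x1 x2 hxq
      have hxr : t ≠ x.rev := fun e => x2.ne (by rw [e, Fin.rev_rev])
      have e2 : t ≠ t.rev := (htq.trans hqt).ne
      refine ⟨hord x t hxr (fun e => hxq e.1) (fun e => x2.ne e.1), fun h => ?_⟩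
      by_contra hc
      refine lt_asymm h (hord t x x2.ne (fun e => htq.ne e.1) (fun e => e2 e.1) ?_)
      exact lt_of_le_of_ne (not_lt.1 hc) fun e => x1.ne (loc_injective _ e)
    -- Apart from the order of opposite letters, the lists of `w` and `w'` differ only in `q`, which
    -- is inert once it is to the left of `t`.
    have hhop : ∀ u, loc u q < loc u t → hop t (lifting w.1 t) u = hop t (lifting w'.1 t) u := by
      intro u hu
      apply hop_lifting_congr hord'
      intro x x1 x2
      by_cases hxq : x = q
      · exact Or.inr (hxq ▸ hu)
      · exact Or.inl (hmem x x1 x2 hxq)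
    have hhead : hop t (lifting w'.1 t) (w' * act hn i v).1 = hop t (lifting w.1 t) (w * v).1 := by
      by_cases hv : Desc hn i v
      · have hv' := (hdv v).1 hv
        rw [act_of_desc hv]
        have e : (w' * v).1 = signedSwap t q * (w * v).1 := by
          rw [Subgroup.coe_mul, hsw, mul_assoc, Subgroup.coe_mul]
        have htar : hopTarget t (lifting w.1 t) (w * v).1 = some q := by
          refine hopTarget_lifting_eq ⟨htq, hqt, hlt, hv'⟩ fun x hx hxq => ?_
          exact lt_of_le_of_ne (hmax x hx.2.2.1 hx.2.1.ne) fun e => hxq (loc_injective _ e)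
        rw [hop_of_some htar, e, hhop]
        rw [loc_signedSwap_mul hqr, loc_signedSwap_mul hqr, if_pos rfl, if_neg htq.ne', if_pos rfl]
        exact hv'
      · rw [act_of_not_desc hv, hw', mul_assoc, simpleReflection_mul_cancel, ← hw', hhop]
        refine lt_of_le_of_ne (not_lt.1 fun h => hv ((hdv v).2 h)) fun e => ?_
        exact htq.ne' (loc_injective _ e)
    rw [hhead]
    -- The later operators see only letters strictly between `t` and `-t`, which `w` and `w'` order
    -- alike up to opposite pairs.
    apply List.foldl_ext
    intro u j hj
    obtain ⟨m, hm, rfl⟩ := List.getElem_of_mem hj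
    rw [List.getElem_drop, List.getElem_finRange]
    set s : Letter n := ⟨k + 1 + m, by
      rw [List.length_drop, List.length_finRange] at hm; omega⟩ with hs
    change hop s (lifting w'.1 s) u = hop s (lifting w.1 s) u
    have hsn : (s : ℕ) + 1 < n := by
      rw [List.length_drop, List.length_finRange] at hm
      simp only [hs]
      omega
    have hts : t < s := by
      rw [Fin.lt_def]
      simp only [hs, ht]
      omega
    have hst : s.rev < t.rev := by rwa [Fin.rev_lt_rev]
    have hss : s < s.rev := by
      rw [Fin.lt_def, Fin.val_rev]
      omega
    symm
    apply hop_lifting_congr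
    · intro x y x1 x2 y1 y2
      exact hord' x y (hts.trans x1) (x2.trans hst) (hts.trans y1) (y2.trans hst)
    · intro x x1 x2
      refine Or.inl (hord' x s (hts.trans x1) (x2.trans hst) hts (hss.trans hst) x1.ne ?_).symm
      exact fun e => x2.ne (by rw [e, Fin.rev_rev])

end Main

end TypeD

theorem mainTheorem1 (n : ℕ) (hn : 2 ≤ n) (w v : TypeD.EvenSignedPerm n) :
    ((TypeD.demazureD hn w v : TypeD.EvenSignedPerm n) : TypeD.SignedPerm n) =
      TypeD.hopAll (w : TypeD.SignedPerm n)
        ((w * v : TypeD.EvenSignedPerm n) : TypeD.SignedPerm n) :=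
  TypeD.demazureD_eq_foldl hn (n - 1) 0 (Nat.zero_add _) w
    (fun _ hx => absurd hx (Nat.not_lt_zero _)) v
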